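/- Let $(M,\omega)$ be a compact symplectic manifold (smooth, finite-dimensional, without boundary) with a Hamiltonian action of a Lie group $G$ and moment map $\mu\colon M\to\mathfrak g^*$; that is, $G$ acts smoothly by symplectomorphisms, $\mu$ is smooth and equivariant for the coadjoint action, and $d\langle\mu,\xi\rangle=\omega(\xi_M,\cdot)$ for every $\xi\in\mathfrak g$, where $\xi_M$ is the vector field on $M$ generated by $\xi$. Let $t\in\mathfrak g^*$ be central (fixed by the coadjoint action) and let $G$ act freely on $\mu^{-1}(t)$. Let $N_t=\mu^{-1}(t)/G$ be the reduced manifold and $\pi_t\colon\mu^{-1}(t)\to N_t$ the projection: $\mu^{-1}(t)$ is an embedded submanifold of $M$ with inclusion $\iota\colon\mu^{-1}(t)\to M$, the quotient space $N_t$ carries a smooth manifold structure for which $\pi_t$ is a submersion, and $N_t$ carries the reduced form $\omega_t$, determined by $\pi_t^*\omega_t=\iota^*\omega$. An immersion (embedding) into $M$ or $N_t$ is called Lagrangian if at every point the image of its differential equals its own orthogonal complement with respect to $\omega$, respectively $\omega_t$. Let $L$ be a smooth manifold. (a) If $f\colon L\to N_t$ is a Lagrangian embedding with image $S_0=f(L)$,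 then $S=\pi_t^{-1}(S_0)\subset\mu^{-1}(t)\subset M$, with the subspace topology, carries a smooth manifold structure for which the inclusion $S\to M$ is a Lagrangian embedding in $(M,\omega)$. (b) If $f\colon L\to N_t$ is a Lagrangian immersion, then its preimage, the fibre product $S=\{(l,z)\in L\times\mu^{-1}(t) : f(l)=\pi_t(z)\}$ with the topology induced from $L\times\mu^{-1}(t)$, carries a smooth manifold structure for which the map $S\to M$, $(l,z)\mapsto z$, is a Lagrangian immersion in $(M,\omega)$. -/

import Mathlib

open scoped Manifold ContDiff Topology
open Manifold

noncomputable section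

/-- A (not necessarily continuous) differential 2-form on a manifold modelled on `E`. -/
abbrev TwoForm (E : Type*) [NormedAddCommGroup E] [NormedSpace ℝ E]
    (M : Type*) [TopologicalSpace M] [ChartedSpace E M] : Type _ :=
  ∀ x : M, (TangentSpace 𝓘(ℝ, E) x) [⋀^Fin 2]→L[ℝ] ℝ

/-- The expression of a 2-form in the preferred chart at `x₀`, that is, its pullback under the
inverse of this chart. Only its values on the (open) target of the chart are meaningful. -/
def TwoForm.inChart {E : Type*} [NormedAddCommGroup E] [NormedSpace ℝ E]
    {M : Type*} [TopologicalSpace M] [ChartedSpace E M]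
    (Ω : TwoForm E M) (x₀ : M) : E → E [⋀^Fin 2]→L[ℝ] ℝ :=
  fun y => (Ω ((extChartAt 𝓘(ℝ, E) x₀).symm y)).compContinuousLinearMap
    (mfderiv 𝓘(ℝ, E) 𝓘(ℝ, E) (extChartAt 𝓘(ℝ, E) x₀).symm y)

/-- A symplectic form: a smooth, closed, nondegenerate 2-form. -/
structure IsSymplecticForm {E : Type*} [NormedAddCommGroup E] [NormedSpace ℝ E]
    {M : Type*} [TopologicalSpace M] [ChartedSpace E M] (Ω : TwoForm E M) : Prop where
  smooth : ∀ x₀ : M, ContDiffOn ℝ ∞ (Ω.inChart x₀) (extChartAt 𝓘(ℝ, E) x₀).target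
  closed : ∀ x₀ : M, ∀ y ∈ (extChartAt 𝓘(ℝ, E) x₀).target, extDeriv (Ω.inChart x₀) y = 0
  nondegenerate : ∀ (x : M) (u : TangentSpace 𝓘(ℝ, E) x), (∀ v, Ω x ![u, v] = 0) → u = 0

section Lagrangian

variable (EL : Type*) [NormedAddCommGroup EL] [NormedSpace ℝ EL]
  {L : Type*} [TopologicalSpace L] [ChartedSpace EL L]
  {E : Type*} [NormedAddCommGroup E] [NormedSpace ℝ E]
  {M : Type*} [TopologicalSpace M] [ChartedSpace E M]

/-- At every point the image of the differential of `f` is a Lagrangian subspace, that is, it is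
equal to its own orthogonal complement with respect to `Ω`. -/
def HasLagrangianTangent (Ω : TwoForm E M) (f : L → M) : Prop :=
  ∀ (x : L) (w : TangentSpace 𝓘(ℝ, E) (f x)),
    (∃ u : TangentSpace 𝓘(ℝ, EL) x, mfderiv 𝓘(ℝ, EL) 𝓘(ℝ, E) f x u = w) ↔
      ∀ u : TangentSpace 𝓘(ℝ, EL) x, Ω (f x) ![w, mfderiv 𝓘(ℝ, EL) 𝓘(ℝ, E) f x u] = 0

/-- A Lagrangian immersion into `(M, Ω)`. -/
structure IsLagrangianImmersion (Ω : TwoForm E M) (f : L → M) : Prop where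
  isImmersion : IsImmersion 𝓘(ℝ, EL) 𝓘(ℝ, E) ∞ f
  lagrangian : HasLagrangianTangent EL Ω f

/-- A Lagrangian embedding into `(M, Ω)`. -/
structure IsLagrangianEmbedding (Ω : TwoForm E M) (f : L → M) : Prop where
  isSmoothEmbedding : IsSmoothEmbedding 𝓘(ℝ, EL) 𝓘(ℝ, E) ∞ f
  lagrangian : HasLagrangianTangent EL Ω f

end Lagrangian

section Hamiltonian

variable {EG : Type*} [NormedAddCommGroup EG] [NormedSpace ℝ EG]
  {G : Type*} [TopologicalSpace G] [ChartedSpace EG G] [Group G]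

/-- The adjoint action of `g` on the Lie algebra: the differential at `1` of `h ↦ g h g⁻¹`. -/
def adjointAction (g : G) :
    GroupLieAlgebra 𝓘(ℝ, EG) G →ₗ[ℝ] GroupLieAlgebra 𝓘(ℝ, EG) G :=
  (mfderiv 𝓘(ℝ, EG) 𝓘(ℝ, EG) (fun h : G => g * h * g⁻¹) 1 : EG →L[ℝ] EG).toLinearMap

/-- The coadjoint action: `⟨Ad*_g l, ξ⟩ = ⟨l, Ad_{g⁻¹} ξ⟩`. -/
def coadjointAction (g : G) (l : Module.Dual ℝ (GroupLieAlgebra 𝓘(ℝ, EG) G)) :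
    Module.Dual ℝ (GroupLieAlgebra 𝓘(ℝ, EG) G) :=
  l ∘ₗ adjointAction g⁻¹

/-- An element of the dual of the Lie algebra is central if it is fixed by the coadjoint action. -/
def IsCentralValue (t : Module.Dual ℝ (GroupLieAlgebra 𝓘(ℝ, EG) G)) : Prop :=
  ∀ g : G, coadjointAction g t = t

variable {E : Type*} [NormedAddCommGroup E] [NormedSpace ℝ E]
  {M : Type*} [TopologicalSpace M] [ChartedSpace E M] [MulAction G M]

/-- The vector field on `M` generated by `ξ`: at `x` it is the derivative at `1` of the orbit map
`g ↦ g • x` in the direction `ξ`. -/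
def fundamentalField (ξ : GroupLieAlgebra 𝓘(ℝ, EG) G) (x : M) : TangentSpace 𝓘(ℝ, E) x :=
  (mfderiv 𝓘(ℝ, EG) 𝓘(ℝ, E) (fun g : G => g • x) 1 : EG →L[ℝ] E) ξ

/-- The action of `G` on `(M, Ω)` is Hamiltonian with moment map `μ`. -/
structure IsHamiltonianAction (Ω : TwoForm E M)
    (μ : M → Module.Dual ℝ (GroupLieAlgebra 𝓘(ℝ, EG) G)) : Prop where
  smooth_action : ContMDiff (𝓘(ℝ, EG).prod 𝓘(ℝ, E)) 𝓘(ℝ, E) ∞ (fun p : G × M => p.1 • p.2)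
  symplectic_action : ∀ (g : G) (x : M) (u v : TangentSpace 𝓘(ℝ, E) x),
    Ω (g • x) ![mfderiv 𝓘(ℝ, E) 𝓘(ℝ, E) (fun y : M => g • y) x u,
      mfderiv 𝓘(ℝ, E) 𝓘(ℝ, E) (fun y : M => g • y) x v] = Ω x ![u, v]
  smooth_moment : ∀ ξ, ContMDiff 𝓘(ℝ, E) 𝓘(ℝ, ℝ) ∞ (fun x => μ x ξ)
  moment : ∀ (ξ) (x : M) (v : TangentSpace 𝓘(ℝ, E) x),
    mfderiv 𝓘(ℝ, E) 𝓘(ℝ, ℝ) (fun y => μ y ξ) x v = Ω x ![fundamentalField ξ x, v]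
  equivariant : ∀ (g : G) (x : M), μ (g • x) = coadjointAction g (μ x)

/-- The level set `μ⁻¹(t)`. -/
abbrev MomentLevel (μ : M → Module.Dual ℝ (GroupLieAlgebra 𝓘(ℝ, EG) G))
    (t : Module.Dual ℝ (GroupLieAlgebra 𝓘(ℝ, EG) G)) : Type _ :=
  {x : M // μ x = t}

/-- Two points of the level set are equivalent if they lie in the same `G`-orbit. -/
abbrev levelOrbitRel (μ : M → Module.Dual ℝ (GroupLieAlgebra 𝓘(ℝ, EG) G))
    (t : Module.Dual ℝ (GroupLieAlgebra 𝓘(ℝ, EG) G)) : Setoid (MomentLevel μ t) :=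
  (MulAction.orbitRel G M).comap Subtype.val

/-- The quotient space `N_t = μ⁻¹(t) / G`, with the quotient topology. -/
abbrev ReducedSpace (μ : M → Module.Dual ℝ (GroupLieAlgebra 𝓘(ℝ, EG) G))
    (t : Module.Dual ℝ (GroupLieAlgebra 𝓘(ℝ, EG) G)) : Type _ :=
  Quotient (levelOrbitRel μ t)

/-- The projection `π_t : μ⁻¹(t) → N_t`. -/
def reductionMap (μ : M → Module.Dual ℝ (GroupLieAlgebra 𝓘(ℝ, EG) G))
    (t : Module.Dual ℝ (GroupLieAlgebra 𝓘(ℝ, EG) G)) : MomentLevel μ t → ReducedSpace μ t :=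
  Quotient.mk (levelOrbitRel μ t)

/-- The preimage `π_t⁻¹(S₀)` of a subset `S₀` of `N_t`, as a subset of `M`. -/
abbrev reductionPreimage (μ : M → Module.Dual ℝ (GroupLieAlgebra 𝓘(ℝ, EG) G))
    (t : Module.Dual ℝ (GroupLieAlgebra 𝓘(ℝ, EG) G)) (S₀ : Set (ReducedSpace μ t)) : Set M :=
  Subtype.val '' (reductionMap μ t ⁻¹' S₀)

/-- The preimage of a map `f : L → N_t`: the fibre product of `f` and `π_t`, with the topology
induced from the product. -/
abbrev reductionPullback (μ : M → Module.Dual ℝ (GroupLieAlgebra 𝓘(ℝ, EG) G))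
    (t : Module.Dual ℝ (GroupLieAlgebra 𝓘(ℝ, EG) G)) {L : Type*} (f : L → ReducedSpace μ t) :
    Type _ :=
  {p : L × MomentLevel μ t // f p.1 = reductionMap μ t p.2}

/-- The given manifold structures on `μ⁻¹(t)` and `N_t` are those of the submanifold and of the
quotient manifold, and `Ωt` is the reduced form. Each of these three objects is determined uniquely
by the corresponding condition: the inclusion `μ⁻¹(t) → M` is a smooth embedding, the projection
`π_t : μ⁻¹(t) → N_t` is a smooth submersion, and the pullback of `Ωt` to `μ⁻¹(t)` is the
restriction of `Ω`. -/
structure IsSymplecticReduction (Ω : TwoForm E M)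
    (μ : M → Module.Dual ℝ (GroupLieAlgebra 𝓘(ℝ, EG) G))
    (t : Module.Dual ℝ (GroupLieAlgebra 𝓘(ℝ, EG) G))
    {EZ : Type*} [NormedAddCommGroup EZ] [NormedSpace ℝ EZ] [ChartedSpace EZ (MomentLevel μ t)]
    {EN : Type*} [NormedAddCommGroup EN] [NormedSpace ℝ EN] [ChartedSpace EN (ReducedSpace μ t)]
    (Ωt : TwoForm EN (ReducedSpace μ t)) : Prop where
  inclusion : IsSmoothEmbedding 𝓘(ℝ, EZ) 𝓘(ℝ, E) ∞ (Subtype.val : MomentLevel μ t → M)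
  projection : IsSubmersion 𝓘(ℝ, EZ) 𝓘(ℝ, EN) ∞ (reductionMap μ t)
  form : ∀ (z : MomentLevel μ t) (u v : TangentSpace 𝓘(ℝ, EZ) z),
    Ωt (reductionMap μ t z) ![mfderiv 𝓘(ℝ, EZ) 𝓘(ℝ, EN) (reductionMap μ t) z u,
        mfderiv 𝓘(ℝ, EZ) 𝓘(ℝ, EN) (reductionMap μ t) z v] =
      Ω z.1 ![mfderiv 𝓘(ℝ, EZ) 𝓘(ℝ, E) (Subtype.val : MomentLevel μ t → M) z u,
        mfderiv 𝓘(ℝ, EZ) 𝓘(ℝ, E) (Subtype.val : MomentLevel μ t → M) z v]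

end Hamiltonian

end

/-! Both cases concern the fibre product S of `f` and the submersion π_t. It is a manifold
(`exists_chartedSpace_fiberProduct`), and by a dimension count each of its tangent spaces is the
fibre product of those of L and μ⁻¹(t) over that of N_t (`LinearMap.exists_eq_of_fiberProduct`).
Since df and dι are injective, so is the differential of S → M, which makes the map an immersion.

The Lagrangian condition is then linear algebra (`lagrangian_of_fiberProduct`). The image of TS is
isotropic because ω restricted to μ⁻¹(t) is the pullback of ω_t, and L is isotropic in N_t.
Conversely, let w be ω-orthogonal to the image of TS. As TS contains ker dπ_t, w is orthogonal to
all vertical vectors, hence tangent to μ⁻¹(t) by coisotropy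
(`exists_tangent_of_orthogonal_vertical`). Then dπ_t(w) is ω_t-orthogonal to TL, so it lies in TL,
and w comes from TS.

Coisotropy is where the moment map enters. Orbit directions ξ_M are vertical, so w ⟂ ξ_M gives
d⟨μ,ξ⟩(w) = 0 for all ξ. Moreover t is a regular value: a free action is locally free
(`eq_zero_of_fundamentalField_eq_zero`), so ξ_M ≠ 0 for ξ ≠ 0, and nondegeneracy gives d⟨μ,ξ⟩ ≠ 0.
The implicit function theorem then realizes w as the velocity of a curve in μ⁻¹(t). -/

/-! ### Inverse function theorem and the immersion criterion. -/

theorem ContDiffOn.exists_openPartialHomeomorph {E E' : Type*} [NormedAddCommGroup E]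
    [NormedSpace ℝ E] [CompleteSpace E] [NormedAddCommGroup E'] [NormedSpace ℝ E']
    {f : E → E'} {s : Set E} (hs : IsOpen s) (hf : ContDiffOn ℝ ∞ f s) {a : E} (ha : a ∈ s)
    (f' : E ≃L[ℝ] E') (hf' : HasFDerivAt f (f' : E →L[ℝ] E') a) :
    ∃ e : OpenPartialHomeomorph E E', a ∈ e.source ∧ e.source ⊆ s ∧ (∀ x, e x = f x) ∧
      ContDiffOn ℝ ∞ e.symm e.target := by
  have hfa : ContDiffAt ℝ ∞ f a := hf.contDiffAt (hs.mem_nhds ha)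
  have hinv : ∀ᶠ x in 𝓝 a, fderiv ℝ f x ∈ Set.range ((↑) : (E ≃L[ℝ] E') → E →L[ℝ] E') := by
    have hc : ContinuousAt (fderiv ℝ f) a :=
      (hfa.fderiv_right (m := 0) (by simp)).continuousAt
    refine hc.eventually ?_
    rw [hf'.fderiv]
    exact ContinuousLinearEquiv.nhds f'
  obtain ⟨t, htsub, hto, hat⟩ := mem_nhds_iff.1 hinv
  set e₀ := hfa.toOpenPartialHomeomorph f hf' (by simp)
  -- On `t` the derivative is invertible at every point, so the inverse is smooth on the whole
  -- target and not only at the image of `a`.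
  refine ⟨e₀.restrOpen (s ∩ t) (hs.inter hto), ?_, ?_, fun x => rfl, ?_⟩
  · exact ⟨hfa.mem_toOpenPartialHomeomorph_source hf' (by simp), ha, hat⟩
  · intro x hx
    exact hx.2.1
  · set e := e₀.restrOpen (s ∩ t) (hs.inter hto)
    intro y hy
    have hys : e.symm y ∈ s ∩ t := (e.map_target hy).2
    obtain ⟨g, hg⟩ := htsub hys.2
    have hfy : ContDiffAt ℝ ∞ f (e.symm y) := hf.contDiffAt (hs.mem_nhds hys.1)
    have hd : HasFDerivAt f (g : E →L[ℝ] E') (e.symm y) := by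
      rw [hg]
      exact (hfy.differentiableAt (by simp)).hasFDerivAt
    exact (e.contDiffAt_symm hy hd hfy).contDiffWithinAt

/-- Any `F` of the missing dimension can be identified with a complement of the range of `A`. -/
theorem LinearMap.exists_prod_equiv_of_injective {E E' F : Type*} [NormedAddCommGroup E]
    [NormedSpace ℝ E] [FiniteDimensional ℝ E] [NormedAddCommGroup E'] [NormedSpace ℝ E']
    [FiniteDimensional ℝ E'] [NormedAddCommGroup F] [NormedSpace ℝ F] [FiniteDimensional ℝ F]
    (hdim : Module.finrank ℝ E + Module.finrank ℝ F = Module.finrank ℝ E')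
    (A : E →L[ℝ] E') (hA : Function.Injective A) :
    ∃ (B : F →L[ℝ] E') (T : (E × F) ≃L[ℝ] E'), ∀ p : E × F, T p = A p.1 + B p.2 := by
  obtain ⟨C, hC⟩ := Submodule.exists_isCompl (LinearMap.range (A : E →ₗ[ℝ] E'))
  have h1 := Submodule.finrank_add_eq_of_isCompl hC
  rw [LinearMap.finrank_range_of_inj (f := (A : E →ₗ[ℝ] E')) hA] at h1
  let e : F ≃ₗ[ℝ] C := LinearEquiv.ofFinrankEq F C (by omega)
  let B : F →ₗ[ℝ] E' := C.subtype ∘ₗ e.toLinearMap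
  let T : (E × F) →ₗ[ℝ] E' := LinearMap.coprod (A : E →ₗ[ℝ] E') B
  have hT : Function.Injective T := by
    rw [← LinearMap.ker_eq_bot, LinearMap.ker_eq_bot']
    rintro ⟨u, v⟩ huv
    have huv' : A u + (e v : E') = 0 := huv
    have h2 : A u = 0 := by
      have hmem : A u ∈ LinearMap.range (A : E →ₗ[ℝ] E') ⊓ C :=
        ⟨⟨u, rfl⟩, by rw [eq_neg_of_add_eq_zero_left huv']; exact C.neg_mem (e v).2⟩
      rwa [hC.inf_eq_bot, Submodule.mem_bot] at hmem
    have h3 : (e v : E') = 0 := by rwa [h2, zero_add] at huv'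
    have h4 : v = 0 := by
      apply e.injective
      rw [map_zero]
      exact Subtype.ext h3
    have h5 : u = 0 := hA (by rw [h2, map_zero])
    rw [h4, h5]; rfl
  refine ⟨LinearMap.toContinuousLinearMap B,
    (LinearEquiv.ofInjectiveOfFinrankEq T hT (by rw [Module.finrank_prod, hdim])).toContinuousLinearEquiv,
    fun p => rfl⟩

/-- A smooth map with injective differential at a point is an immersion there. -/
theorem Manifold.IsImmersionAtOfComplement.of_injective_mfderiv {E E' F : Type*}
    [NormedAddCommGroup E]
    [NormedSpace ℝ E] [FiniteDimensional ℝ E] [NormedAddCommGroup E'] [NormedSpace ℝ E']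
    [FiniteDimensional ℝ E'] [NormedAddCommGroup F] [NormedSpace ℝ F] [FiniteDimensional ℝ F]
    {M N : Type*} [TopologicalSpace M] [ChartedSpace E M] [IsManifold 𝓘(ℝ, E) ∞ M]
    [TopologicalSpace N] [ChartedSpace E' N] [IsManifold 𝓘(ℝ, E') ∞ N]
    (hdim : Module.finrank ℝ E + Module.finrank ℝ F = Module.finrank ℝ E')
    {f : M → N} (hf : ContMDiff 𝓘(ℝ, E) 𝓘(ℝ, E') ∞ f) (x : M)
    (hinj : Function.Injective (mfderiv 𝓘(ℝ, E) 𝓘(ℝ, E') f x)) :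
    IsImmersionAtOfComplement F 𝓘(ℝ, E) 𝓘(ℝ, E') ∞ f x := by
  let φ := chartAt E x
  let ψ := chartAt E' (f x)
  let h : E → E' := ψ ∘ f ∘ φ.symm
  let O : Set E := φ.target ∩ φ.symm ⁻¹' (f ⁻¹' ψ.source)
  have hO : IsOpen O := φ.isOpen_inter_preimage_symm (ψ.open_source.preimage hf.continuous)
  have hh : ContDiffOn ℝ ∞ h O := by
    rw [← contMDiffOn_iff_contDiffOn]
    refine (contMDiffOn_chart (I := 𝓘(ℝ, E')) (x := f x)).comp
      (hf.comp_contMDiffOn ((contMDiffOn_chart_symm (I := 𝓘(ℝ, E)) (x := x)).mono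
        Set.inter_subset_left)) ?_
    exact fun y hy => hy.2
  have hxO : φ x ∈ O := by
    refine ⟨φ.map_source (mem_chart_source E x), ?_⟩
    change f (φ.symm (φ x)) ∈ ψ.source
    rw [φ.left_inv (mem_chart_source E x)]
    exact mem_chart_source E' (f x)
  let A : E →L[ℝ] E' := mfderiv 𝓘(ℝ, E) 𝓘(ℝ, E') f x
  have hA : HasFDerivAt h A (φ x) := by
    have h1 := (hf.mdifferentiable (by simp) x).hasMFDerivAt.2
    simp only [writtenInExtChartAt, extChartAt, mfld_simps] at h1
    exact hasFDerivWithinAt_univ.1 h1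
  obtain ⟨B, T, hT⟩ := LinearMap.exists_prod_equiv_of_injective hdim A hinj
  -- Thickening `h` by directions transverse to its image gives a local diffeomorphism, whose
  -- inverse straightens the image of `f` to the slice E × 0.
  let H : E × F → E' := fun p => h p.1 + B p.2
  have hH : ContDiffOn ℝ ∞ H (O ×ˢ Set.univ) :=
    (hh.comp contDiff_fst.contDiffOn (fun p hp => hp.1)).add (by fun_prop)
  have hH' : HasFDerivAt H (T : (E × F) →L[ℝ] E') (φ x, (0 : F)) := by
    have h1 : HasFDerivAt H (A.comp (ContinuousLinearMap.fst ℝ E F) +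
        B.comp (ContinuousLinearMap.snd ℝ E F)) (φ x, (0 : F)) :=
      (HasFDerivAt.comp (φ x, (0 : F)) (f := Prod.fst) hA hasFDerivAt_fst).add
        (B.hasFDerivAt.comp (φ x, (0 : F)) hasFDerivAt_snd)
    convert h1 using 1
    exact ContinuousLinearMap.ext hT
  obtain ⟨e, hea, hes, hef, hesymm⟩ := hH.exists_openPartialHomeomorph
    (hO.prod isOpen_univ) (a := (φ x, (0 : F))) ⟨hxO, trivial⟩ T hH'
  let W : Set E := (fun u : E => (u, (0 : F))) ⁻¹' e.source
  have hW : IsOpen W := e.open_source.preimage (by fun_prop)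
  let domChart : OpenPartialHomeomorph M E := φ.trans (OpenPartialHomeomorph.ofSet W hW)
  -- `e.symm` takes values in `E × F`; composing with `T` moves them to the model space `E'`.
  let codChart : OpenPartialHomeomorph N E' :=
    (ψ.trans e.symm).trans T.toHomeomorph.toOpenPartialHomeomorph
  have hdom : domChart ∈ IsManifold.maximalAtlas 𝓘(ℝ, E) ∞ M := by
    apply OpenPartialHomeomorph.mem_maximalAtlas_of_contMDiffOn
    · exact (contMDiffOn_chart (I := 𝓘(ℝ, E)) (x := x)).mono (fun y hy => hy.1)
    · refine (contMDiffOn_chart_symm (I := 𝓘(ℝ, E)) (x := x)).mono (fun y hy => hy.2)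
  have hcod : codChart ∈ IsManifold.maximalAtlas 𝓘(ℝ, E') ∞ N := by
    apply OpenPartialHomeomorph.mem_maximalAtlas_of_contMDiffOn
    · have h1 : ContMDiffOn 𝓘(ℝ, E') 𝓘(ℝ, E') ∞ (T ∘ e.symm) e.target :=
        contMDiffOn_iff_contDiffOn.2 (T.contDiff.comp_contDiffOn hesymm)
      refine h1.comp ((contMDiffOn_chart (I := 𝓘(ℝ, E')) (x := f x)).mono
        (fun y hy => hy.1.1)) (fun y hy => hy.1.2)
    · have h1 : ContMDiffOn 𝓘(ℝ, E') 𝓘(ℝ, E') ∞ (e ∘ T.symm) (T.symm ⁻¹' e.source) := by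
        refine contMDiffOn_iff_contDiffOn.2 ?_
        refine (hH.congr (fun p _ => hef p)).comp T.symm.contDiff.contDiffOn
          (fun y hy => hes hy)
      exact (contMDiffOn_chart_symm (I := 𝓘(ℝ, E')) (x := f x)).comp
        (h1.mono (fun y hy => hy.2.1)) (fun y hy => hy.2.2)
  refine IsImmersionAtOfComplement.mk_of_continuousAt hf.continuous.continuousAt T domChart codChart
    ⟨mem_chart_source E x, hea⟩ ⟨⟨mem_chart_source E' (f x), ?_⟩, trivial⟩ hdom hcod ?_
  · have : ψ (f x) = e (φ x, 0) := by
      rw [hef]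
      simp [H, h, φ, φ.left_inv (mem_chart_source E x)]
    change ψ (f x) ∈ e.target
    rw [this]
    exact e.map_source hea
  · intro u hu
    have hu' : u ∈ W ∧ u ∈ φ.target := by simpa [domChart] using hu
    have h1 : e (u, 0) = ψ (f (φ.symm u)) := by
      rw [hef]; simp [H, h]
    change T (e.symm (ψ (f (φ.symm u)))) = T (u, 0)
    rw [← h1, e.left_inv hu'.1]

/-! ### Manifold structures on subspaces from local parametrizations. -/

/-- The chart of a subspace `j : S → P` given by a map `r` of the ambient space, with inverse the
local parametrization `σ`. -/
noncomputable def Topology.IsEmbedding.chartOfParametrization {S P H : Type*} [TopologicalSpace S]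
    [TopologicalSpace P] [TopologicalSpace H] [Nonempty S] {j : S → P} (hj : IsEmbedding j) {U : Set P}
    {V : Set H} {r : P → H} {σ : H → P} (hU : IsOpen U) (hV : IsOpen V) (hr : ContinuousOn r U)
    (hσ : ContinuousOn σ V) (hrV : ∀ s, j s ∈ U → r (j s) ∈ V) (hσr : ∀ s, j s ∈ U → σ (r (j s)) = j s)
    (hσU : ∀ h ∈ V, σ h ∈ U) (hσj : ∀ h ∈ V, σ h ∈ Set.range j) (hrσ : ∀ h ∈ V, r (σ h) = h) :
    OpenPartialHomeomorph S H where
  toFun := r ∘ j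
  invFun h := Function.invFun j (σ h)
  source := j ⁻¹' U
  target := V
  map_source' s hs := hrV s hs
  map_target' h hh := by
    change j (Function.invFun j (σ h)) ∈ U
    rw [Function.invFun_eq (hσj h hh)]
    exact hσU h hh
  left_inv' s hs := by
    change Function.invFun j (σ (r (j s))) = s
    rw [hσr s hs]
    exact Function.leftInverse_invFun hj.injective s
  right_inv' h hh := by
    change r (j (Function.invFun j (σ h))) = h
    rw [Function.invFun_eq (hσj h hh), hrσ h hh]
  open_source := hU.preimage hj.continuous
  open_target := hV
  continuousOn_toFun := hr.comp hj.continuous.continuousOn (fun _ hs => hs)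
  continuousOn_invFun := by
    rw [hj.continuousOn_iff]
    exact hσ.congr (fun h hh => Function.invFun_eq (hσj h hh))

/-- A map with a differentiable local left inverse has an injective differential. -/
theorem injective_mfderiv_of_leftInverse {E E' H H' : Type*} [NormedAddCommGroup E]
    [NormedSpace ℝ E] [NormedAddCommGroup E'] [NormedSpace ℝ E'] [TopologicalSpace H]
    [TopologicalSpace H'] {I : ModelWithCorners ℝ E H} {I' : ModelWithCorners ℝ E' H'}
    {M N : Type*} [TopologicalSpace M] [ChartedSpace H M] [TopologicalSpace N] [ChartedSpace H' N]
    {f : M → N} {g : N → M} {x : M} (hf : MDifferentiableAt I I' f x)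
    (hg : MDifferentiableAt I' I g (f x)) (hgf : ∀ᶠ y in 𝓝 x, g (f y) = y) :
    Function.Injective (mfderiv I I' f x) := by
  have h1 : HasMFDerivAt I I (g ∘ f) x ((mfderiv I' I g (f x)).comp (mfderiv I I' f x)) :=
    hg.hasMFDerivAt.comp x hf.hasMFDerivAt
  have h2 : HasMFDerivAt I I (g ∘ f) x (ContinuousLinearMap.id ℝ (TangentSpace I x)) :=
    (hasMFDerivAt_id x).congr_of_eventuallyEq hgf
  have h3 : ∀ u : TangentSpace I x, mfderiv I' I g (f x) (mfderiv I I' f x u) = u := fun u =>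
    congrArg (fun T : E →L[ℝ] E => T u) (hasMFDerivAt_unique h1 h2)
  intro u v huv
  rw [← h3 u, ← h3 v, huv]

/-- A subspace with smooth local parametrizations that have smooth local left inverses is a
manifold, and its inclusion is smooth with injective differential. -/
theorem exists_chartedSpace_of_parametrizations {EP HP P EH S : Type*} [NormedAddCommGroup EP]
    [NormedSpace ℝ EP] [TopologicalSpace HP] (I : ModelWithCorners ℝ EP HP) [TopologicalSpace P]
    [ChartedSpace HP P] [NormedAddCommGroup EH] [NormedSpace ℝ EH] [TopologicalSpace S]
    {j : S → P} (hj : Topology.IsEmbedding j)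
    (hloc : ∀ s, ∃ (U : Set P) (V : Set EH) (r : P → EH) (σ : EH → P), IsOpen U ∧ IsOpen V ∧
      j s ∈ U ∧ ContMDiffOn I 𝓘(ℝ, EH) ∞ r U ∧ ContMDiffOn 𝓘(ℝ, EH) I ∞ σ V ∧
      (∀ s', j s' ∈ U → r (j s') ∈ V ∧ σ (r (j s')) = j s') ∧
      (∀ h ∈ V, σ h ∈ U ∧ σ h ∈ Set.range j ∧ r (σ h) = h)) :
    ∃ _ : ChartedSpace EH S, IsManifold 𝓘(ℝ, EH) ∞ S ∧ ContMDiff 𝓘(ℝ, EH) I ∞ j ∧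
      ∀ s, Function.Injective (mfderiv 𝓘(ℝ, EH) I j s) := by
  choose U V r σ hU hV hs hr hσ hUV hVU using hloc
  let e : S → OpenPartialHomeomorph S EH := fun s =>
    haveI : Nonempty S := ⟨s⟩
    hj.chartOfParametrization (hU s) (hV s) (hr s).continuousOn (hσ s).continuousOn
      (fun s' h => (hUV s s' h).1) (fun s' h => (hUV s s' h).2) (fun h hh => (hVU s h hh).1)
      (fun h hh => (hVU s h hh).2.1) (fun h hh => (hVU s h hh).2.2)
  have hje : ∀ s, ∀ h ∈ V s, j ((e s).symm h) = σ s h := fun s h hh =>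
    haveI : Nonempty S := ⟨s⟩
    Function.invFun_eq (hVU s h hh).2.1
  let cs : ChartedSpace EH S :=
    { atlas := Set.range e
      chartAt := e
      mem_chart_source := hs
      chart_mem_atlas := fun s => ⟨s, rfl⟩ }
  have hman : IsManifold 𝓘(ℝ, EH) ∞ S := by
    apply isManifold_of_contDiffOn
    rintro _ _ ⟨s, rfl⟩ ⟨s', rfl⟩
    -- The transition maps factor through the ambient manifold, which is why they are smooth.
    have h1 : ContMDiffOn 𝓘(ℝ, EH) 𝓘(ℝ, EH) ∞ (r s' ∘ σ s) ((e s).symm ≫ₕ e s').source := by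
      refine (hr s').comp ((hσ s).mono (fun h hh => hh.1)) (fun h hh => ?_)
      have h2 : j ((e s).symm h) ∈ U s' := hh.2
      rwa [hje s h hh.1] at h2
    refine (contMDiffOn_iff_contDiffOn.1 h1).congr_mono (fun h hh => ?_) (fun h hh => hh.1)
    exact congrArg (r s') (hje s h hh.1.1)
  have hjs : ContMDiff 𝓘(ℝ, EH) I ∞ j := by
    intro s
    have h1 : ContMDiffOn 𝓘(ℝ, EH) I ∞ (σ s ∘ e s) (e s).source :=
      (hσ s).comp (contMDiffOn_chart (I := 𝓘(ℝ, EH)) (x := s)) (fun s' hs' => (hUV s s' hs').1)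
    exact (h1.congr (fun s' hs' => (hUV s s' hs').2.symm)).contMDiffAt
      ((e s).open_source.mem_nhds (hs s))
  refine ⟨cs, hman, hjs, fun s => ?_⟩
  have hes : ContMDiffAt 𝓘(ℝ, EH) 𝓘(ℝ, EH) ∞ (e s).symm (e s s) :=
    (contMDiffOn_chart_symm (I := 𝓘(ℝ, EH)) (x := s)).contMDiffAt
      ((e s).open_target.mem_nhds ((e s).map_source (hs s)))
  refine injective_mfderiv_of_leftInverse (g := (e s).symm ∘ r s)
    (hjs.mdifferentiable (by simp) s) ?_ ?_
  · exact (hes.comp (j s) ((hr s).contMDiffAt ((hU s).mem_nhds (hs s)))).mdifferentiableAt (by simp)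
  · filter_upwards [(e s).open_source.mem_nhds (hs s)] with s' hs'
    exact (e s).left_inv hs'

/-! ### Local normal forms of immersions and submersions. -/

/-- An immersion has a smooth local left inverse. -/
theorem Manifold.IsImmersionAtOfComplement.exists_leftInverse {E E' F : Type*}
    [NormedAddCommGroup E] [NormedSpace ℝ E] [NormedAddCommGroup E'] [NormedSpace ℝ E']
    [NormedAddCommGroup F] [NormedSpace ℝ F]
    {M N : Type*} [TopologicalSpace M] [ChartedSpace E M] [IsManifold 𝓘(ℝ, E) ∞ M]
    [TopologicalSpace N] [ChartedSpace E' N] [IsManifold 𝓘(ℝ, E') ∞ N]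
    {f : M → N} {x : M} (h : IsImmersionAtOfComplement F 𝓘(ℝ, E) 𝓘(ℝ, E') ∞ f x) :
    ∃ g : N → M, ContMDiffAt 𝓘(ℝ, E') 𝓘(ℝ, E) ∞ g (f x) ∧ ∀ᶠ y in 𝓝 x, g (f y) = y := by
  have hkey : ∀ y ∈ h.domChart.source,
      (h.equiv.symm (h.codChart (f y))).1 = h.domChart y := by
    intro y hy
    have h1 := h.writtenInCharts (show h.domChart y ∈ _ by simpa using h.domChart.map_source hy)
    have h2 : h.codChart (f y) = h.equiv (h.domChart y, 0) := by
      simpa [h.domChart.left_inv hy] using h1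
    rw [h2]; simp
  refine ⟨fun z => h.domChart.symm (h.equiv.symm (h.codChart z)).1, ?_, ?_⟩
  · have h1 : ContMDiffAt 𝓘(ℝ, E') 𝓘(ℝ, E) ∞ (fun z => (h.equiv.symm (h.codChart z)).1) (f x) :=
      ContMDiffAt.comp (f x) (I' := 𝓘(ℝ, E'))
        (g := fun w : E' => (h.equiv.symm w).1) (contMDiffAt_iff_contDiffAt.2 (by fun_prop))
        (contMDiffAt_of_mem_maximalAtlas h.codChart_mem_maximalAtlas h.mem_codChart_source)
    refine ContMDiffAt.comp (f x) ?_ h1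
    apply contMDiffAt_symm_of_mem_maximalAtlas h.domChart_mem_maximalAtlas
    rw [hkey x h.mem_domChart_source]
    exact h.domChart.map_source h.mem_domChart_source
  · filter_upwards [h.domChart.open_source.mem_nhds h.mem_domChart_source] with y hy
    rw [hkey y hy, h.domChart.left_inv hy]

/-- A submersion in charts: smooth local coordinates `(π, q)`, with the inverse of these. -/
theorem Manifold.IsSubmersionAtOfComplement.exists_trivialization {E E' F : Type*}
    [NormedAddCommGroup E] [NormedSpace ℝ E] [NormedAddCommGroup E'] [NormedSpace ℝ E']
    [NormedAddCommGroup F] [NormedSpace ℝ F]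
    {M N : Type*} [TopologicalSpace M] [ChartedSpace E M] [IsManifold 𝓘(ℝ, E) ∞ M]
    [TopologicalSpace N] [ChartedSpace E' N] [IsManifold 𝓘(ℝ, E') ∞ N]
    {f : M → N} {x : M} (h : IsSubmersionAtOfComplement F 𝓘(ℝ, E) 𝓘(ℝ, E') ∞ f x) :
    ∃ (U : Set M) (W : Set (N × F)) (q : M → F) (τ : N × F → M), IsOpen U ∧ IsOpen W ∧ x ∈ U ∧
      ContMDiffOn 𝓘(ℝ, E) 𝓘(ℝ, F) ∞ q U ∧
      ContMDiffOn (𝓘(ℝ, E').prod 𝓘(ℝ, F)) 𝓘(ℝ, E) ∞ τ W ∧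
      (∀ y ∈ U, (f y, q y) ∈ W ∧ τ (f y, q y) = y) ∧
      (∀ p ∈ W, τ p ∈ U ∧ f (τ p) = p.1 ∧ q (τ p) = p.2) := by
  have hkey : ∀ y ∈ h.domChart.source, (h.equiv (h.domChart y)).1 = h.codChart (f y) := by
    intro y hy
    have h1 := h.writtenInCharts (show h.domChart y ∈ _ by simpa using h.domChart.map_source hy)
    have h2 : h.codChart (f y) = (h.equiv (h.domChart y)).1 := by
      simpa [h.domChart.left_inv hy] using h1
    exact h2.symm
  -- In the charts the submersion is the first projection, so these are the coordinates of the point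
  -- over `p.1` with fibre coordinate `p.2`.
  let a : N × F → E := fun p => h.equiv.symm (h.codChart p.1, p.2)
  have ha : ContMDiffOn (𝓘(ℝ, E').prod 𝓘(ℝ, F)) 𝓘(ℝ, E) ∞ a
      (h.codChart.source ×ˢ Set.univ) := by
    have h1 : ContMDiffOn (𝓘(ℝ, E').prod 𝓘(ℝ, F)) 𝓘(ℝ, E' × F) ∞
        (fun p : N × F => (h.codChart p.1, p.2)) (h.codChart.source ×ˢ Set.univ) := by
      refine ContMDiffOn.prodMk_space ?_ contMDiff_snd.contMDiffOn
      exact (contMDiffOn_of_mem_maximalAtlas h.codChart_mem_maximalAtlas).comp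
        contMDiff_fst.contMDiffOn (fun p hp => hp.1)
    exact (contMDiff_iff_contDiff.2 h.equiv.symm.contDiff).comp_contMDiffOn h1
  let W : Set (N × F) := (h.codChart.source ×ˢ Set.univ) ∩ a ⁻¹' h.domChart.target
  have hW : IsOpen W := ha.continuousOn.isOpen_inter_preimage
    (h.codChart.open_source.prod isOpen_univ) h.domChart.open_target
  refine ⟨h.domChart.source, W, fun y => (h.equiv (h.domChart y)).2,
    fun p => h.domChart.symm (a p), h.domChart.open_source, hW, h.mem_domChart_source,
    ?_, ?_, ?_, ?_⟩
  · have h1 : ContDiff ℝ ∞ (fun w : E => (h.equiv w).2) := by fun_prop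
    exact (contMDiff_iff_contDiff.2 h1).comp_contMDiffOn
      (contMDiffOn_of_mem_maximalAtlas h.domChart_mem_maximalAtlas)
  · exact (contMDiffOn_symm_of_mem_maximalAtlas h.domChart_mem_maximalAtlas).comp
      (ha.mono Set.inter_subset_left) (fun p hp => hp.2)
  · intro y hy
    have h1 : a (f y, (h.equiv (h.domChart y)).2) = h.domChart y := by
      change h.equiv.symm (h.codChart (f y), _) = _
      rw [← hkey y hy]; simp
    refine ⟨⟨⟨h.source_subset_preimage_source hy, trivial⟩, ?_⟩, ?_⟩
    · change a _ ∈ h.domChart.target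
      rw [h1]
      exact h.domChart.map_source hy
    · change h.domChart.symm (a _) = y
      rw [h1, h.domChart.left_inv hy]
  · rintro p ⟨hp1, hp2⟩
    have h1 : h.domChart.symm (a p) ∈ h.domChart.source := h.domChart.map_target hp2
    have h2 : h.equiv (h.domChart (h.domChart.symm (a p))) = (h.codChart p.1, p.2) := by
      rw [h.domChart.right_inv hp2]; simp [a]
    refine ⟨h1, ?_, congrArg Prod.snd h2⟩
    have h3 := hkey _ h1
    rw [h2] at h3
    exact (h.codChart.injOn hp1.1 (h.source_subset_preimage_source h1) h3).symm

/-- A submersion has a surjective differential. -/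
theorem Manifold.IsSubmersionAtOfComplement.surjective_mfderiv {E E' F : Type*}
    [NormedAddCommGroup E] [NormedSpace ℝ E] [NormedAddCommGroup E'] [NormedSpace ℝ E']
    [NormedAddCommGroup F] [NormedSpace ℝ F]
    {M N : Type*} [TopologicalSpace M] [ChartedSpace E M] [IsManifold 𝓘(ℝ, E) ∞ M]
    [TopologicalSpace N] [ChartedSpace E' N] [IsManifold 𝓘(ℝ, E') ∞ N]
    {f : M → N} {x : M} (h : IsSubmersionAtOfComplement F 𝓘(ℝ, E) 𝓘(ℝ, E') ∞ f x) :
    Function.Surjective (mfderiv 𝓘(ℝ, E) 𝓘(ℝ, E') f x) := by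
  obtain ⟨U, W, q, τ, -, hW, hxU, -, hτ, hUW, hWU⟩ := h.exists_trivialization
  -- Freezing the fibre coordinate gives a local section through `x`; its differential is a right
  -- inverse.
  let s : N → M := fun n => τ (n, q x)
  have hsx : s (f x) = x := (hUW x hxU).2
  have hs : MDifferentiableAt 𝓘(ℝ, E') 𝓘(ℝ, E) s (f x) := by
    have h1 : ContMDiffAt 𝓘(ℝ, E') 𝓘(ℝ, E) ∞ s (f x) :=
      ContMDiffAt.comp (f x) (hτ.contMDiffAt (hW.mem_nhds (hUW x hxU).1))
        (contMDiffAt_id.prodMk contMDiffAt_const)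
    exact h1.mdifferentiableAt (by simp)
  have hf : MDifferentiableAt 𝓘(ℝ, E) 𝓘(ℝ, E') f (s (f x)) := by
    rw [hsx]
    exact h.contMDiffAt.mdifferentiableAt (by simp)
  have hfs : ∀ᶠ n in 𝓝 (f x), (f ∘ s) n = n := by
    have h1 : (fun n : N => (n, q x)) ⁻¹' W ∈ 𝓝 (f x) :=
      (hW.preimage (by fun_prop)).mem_nhds (hUW x hxU).1
    filter_upwards [h1] with n hn
    exact (hWU _ hn).2.1
  have h1 := hf.hasMFDerivAt.comp (f x) hs.hasMFDerivAt
  have h2 : HasMFDerivAt 𝓘(ℝ, E') 𝓘(ℝ, E') (f ∘ s) (f x)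
      (ContinuousLinearMap.id ℝ (TangentSpace 𝓘(ℝ, E') (f x))) :=
    (hasMFDerivAt_id (f x)).congr_of_eventuallyEq hfs
  have h3 : ∀ u : E', mfderiv 𝓘(ℝ, E) 𝓘(ℝ, E') f (s (f x))
      (mfderiv 𝓘(ℝ, E') 𝓘(ℝ, E) s (f x) u) = u := fun u =>
    congrArg (fun T : E' →L[ℝ] E' => T u) (hasMFDerivAt_unique h1 h2)
  rw [hsx] at h3
  exact fun u => ⟨_, h3 u⟩

/-! ### Fibre products and their tangent spaces. -/

/-- The fibre product of a smooth map and a submersion is a manifold. -/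
theorem exists_chartedSpace_fiberProduct {EL EZ EN F EH L Z N S : Type*}
    [NormedAddCommGroup EL] [NormedSpace ℝ EL] [NormedAddCommGroup EZ] [NormedSpace ℝ EZ]
    [NormedAddCommGroup EN] [NormedSpace ℝ EN] [NormedAddCommGroup F] [NormedSpace ℝ F]
    [NormedAddCommGroup EH] [NormedSpace ℝ EH] (T : (EL × F) ≃L[ℝ] EH)
    [TopologicalSpace L] [ChartedSpace EL L] [IsManifold 𝓘(ℝ, EL) ∞ L]
    [TopologicalSpace Z] [ChartedSpace EZ Z] [IsManifold 𝓘(ℝ, EZ) ∞ Z]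
    [TopologicalSpace N] [ChartedSpace EN N] [IsManifold 𝓘(ℝ, EN) ∞ N] [TopologicalSpace S]
    {f : L → N} {π : Z → N} (hf : ContMDiff 𝓘(ℝ, EL) 𝓘(ℝ, EN) ∞ f)
    (hπ : IsSubmersionOfComplement F 𝓘(ℝ, EZ) 𝓘(ℝ, EN) ∞ π)
    {j : S → L × Z} (hj : Topology.IsEmbedding j)
    (hrange : ∀ p : L × Z, p ∈ Set.range j ↔ f p.1 = π p.2) :
    ∃ _ : ChartedSpace EH S, IsManifold 𝓘(ℝ, EH) ∞ S ∧
      ContMDiff 𝓘(ℝ, EH) (𝓘(ℝ, EL).prod 𝓘(ℝ, EZ)) ∞ j ∧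
      ∀ s, Function.Injective (mfderiv 𝓘(ℝ, EH) (𝓘(ℝ, EL).prod 𝓘(ℝ, EZ)) j s) := by
  refine exists_chartedSpace_of_parametrizations (𝓘(ℝ, EL).prod 𝓘(ℝ, EZ)) hj fun s => ?_
  obtain ⟨U, W, q, τ, hU, hW, hsU, hq, hτ, hUW, hWU⟩ := (hπ (j s).2).exists_trivialization
  let χ := chartAt EL (j s).1
  have hχ : ContMDiffOn 𝓘(ℝ, EL) 𝓘(ℝ, EL) ∞ χ χ.source := contMDiffOn_chart
  have hχ' : ContMDiffOn 𝓘(ℝ, EL) 𝓘(ℝ, EL) ∞ χ.symm χ.target := contMDiffOn_chart_symm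
  let D : Set EH := (fun h => (T.symm h).1) ⁻¹' χ.target
  have hD : IsOpen D := χ.open_target.preimage (by fun_prop)
  let lmap : EH → L := fun h => χ.symm (T.symm h).1
  have hl : ContMDiffOn 𝓘(ℝ, EH) 𝓘(ℝ, EL) ∞ lmap D := by
    have h1 : ContDiff ℝ ∞ (fun h : EH => (T.symm h).1) := by fun_prop
    exact hχ'.comp (contMDiff_iff_contDiff.2 h1).contMDiffOn (fun h hh => hh)
  -- A point of the fibre product is determined by `l` and the fibre coordinate of the second
  -- component, whose base point must be `f l`.
  let b : EH → N × F := fun h => (f (lmap h), (T.symm h).2)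
  have hb : ContMDiffOn 𝓘(ℝ, EH) (𝓘(ℝ, EN).prod 𝓘(ℝ, F)) ∞ b D := by
    have h1 : ContDiff ℝ ∞ (fun h : EH => (T.symm h).2) := by fun_prop
    exact (hf.comp_contMDiffOn hl).prodMk (contMDiff_iff_contDiff.2 h1).contMDiffOn
  refine ⟨χ.source ×ˢ U, D ∩ b ⁻¹' W, fun p => T (χ p.1, q p.2), fun h => (lmap h, τ (b h)),
    χ.open_source.prod hU, hb.continuousOn.isOpen_inter_preimage hD hW,
    ⟨mem_chart_source EL _, hsU⟩, ?_, ?_, ?_, ?_⟩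
  · have h1 : ContMDiffOn (𝓘(ℝ, EL).prod 𝓘(ℝ, EZ)) 𝓘(ℝ, EL × F) ∞
        (fun p : L × Z => (χ p.1, q p.2)) (χ.source ×ˢ U) :=
      (hχ.comp contMDiff_fst.contMDiffOn (fun p hp => hp.1)).prodMk_space
        (hq.comp contMDiff_snd.contMDiffOn (fun p hp => hp.2))
    exact (contMDiff_iff_contDiff.2 T.contDiff).comp_contMDiffOn h1
  · exact (hl.mono Set.inter_subset_left).prodMk
      (hτ.comp (hb.mono Set.inter_subset_left) (fun h hh => hh.2))
  · rintro s' ⟨hs1, hs2⟩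
    have hfs : f (j s').1 = π (j s').2 := (hrange _).1 ⟨s', rfl⟩
    have h1 : lmap (T (χ (j s').1, q (j s').2)) = (j s').1 := by
      simp [lmap, χ.left_inv hs1]
    have h2 : b (T (χ (j s').1, q (j s').2)) = (π (j s').2, q (j s').2) := by
      change (f (lmap _), _) = _
      rw [h1, hfs]; simp
    refine ⟨⟨?_, ?_⟩, ?_⟩
    · simpa [D] using χ.map_source hs1
    · change b _ ∈ W
      rw [h2]
      exact (hUW _ hs2).1
    · change (lmap _, τ (b _)) = _
      rw [h1, h2, (hUW _ hs2).2]
  · rintro h ⟨hh1, hh2⟩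
    obtain ⟨h3, h4, h5⟩ := hWU _ hh2
    refine ⟨⟨χ.map_target hh1, h3⟩, (hrange _).2 h4.symm, ?_⟩
    change T (χ (χ.symm (T.symm h).1), q (τ (b h))) = h
    rw [χ.right_inv hh1, h5]
    exact T.apply_symm_apply h

/-- The linear fibre product is the kernel of (a, b) ↦ f a − g b, which is onto `N` because `g` is.
The range of `c` lies in this kernel and has the same dimension. -/
theorem LinearMap.exists_eq_of_fiberProduct {H A B N : Type*} [AddCommGroup H] [Module ℝ H]
    [AddCommGroup A] [Module ℝ A] [AddCommGroup B] [Module ℝ B] [AddCommGroup N] [Module ℝ N]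
    [FiniteDimensional ℝ H] [FiniteDimensional ℝ A] [FiniteDimensional ℝ B]
    [FiniteDimensional ℝ N] (c : H →ₗ[ℝ] A × B) (hc : Function.Injective c) (f : A →ₗ[ℝ] N)
    (g : B →ₗ[ℝ] N) (hg : Function.Surjective g) (hcomm : ∀ u, f (c u).1 = g (c u).2)
    (hdim : Module.finrank ℝ H + Module.finrank ℝ N = Module.finrank ℝ A + Module.finrank ℝ B)
    (a : A) (b : B) (hab : f a = g b) : ∃ u, c u = (a, b) := by
  let D : A × B →ₗ[ℝ] N := LinearMap.coprod f (-g)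
  have hD : ∀ p, D p = f p.1 - g p.2 := fun p => by simp [D, sub_eq_add_neg]
  have hDs : LinearMap.range D = ⊤ := by
    rw [LinearMap.range_eq_top]
    intro n
    obtain ⟨b, hb⟩ := hg (-n)
    exact ⟨(0, b), by rw [hD]; simp [hb]⟩
  have h1 := D.finrank_range_add_finrank_ker
  rw [hDs, finrank_top, Module.finrank_prod] at h1
  have hle : LinearMap.range c ≤ LinearMap.ker D := by
    rintro _ ⟨u, rfl⟩
    rw [LinearMap.mem_ker, hD, hcomm, sub_self]
  have heq : LinearMap.range c = LinearMap.ker D :=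
    Submodule.eq_of_le_of_finrank_eq hle (by rw [LinearMap.finrank_range_of_inj hc]; omega)
  have h2 : (a, b) ∈ LinearMap.ker D := by rw [LinearMap.mem_ker, hD, hab, sub_self]
  rw [← heq] at h2
  exact h2

/-! ### Free actions are locally free. -/

theorem eventually_const_of_hasMFDerivAt_zero {E : Type*} [NormedAddCommGroup E]
    [NormedSpace ℝ E] {M : Type*} [TopologicalSpace M] [ChartedSpace E M]
    [IsManifold 𝓘(ℝ, E) ∞ M] {c : ℝ → M} {s₀ : ℝ}
    (hc : ∀ᶠ s in 𝓝 s₀, HasMFDerivAt 𝓘(ℝ, ℝ) 𝓘(ℝ, E) c s 0) : ∀ᶠ s in 𝓝 s₀, c s = c s₀ := by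
  let φ := chartAt E (c s₀)
  have hcont : ContinuousAt c s₀ := hc.self_of_nhds.continuousAt
  have hsrc : ∀ᶠ s in 𝓝 s₀, c s ∈ φ.source :=
    hcont.eventually (φ.open_source.mem_nhds (mem_chart_source E _))
  obtain ⟨ε, hε, hball⟩ := Metric.eventually_nhds_iff_ball.1 (hc.and hsrc)
  have hd : ∀ s ∈ Metric.ball s₀ ε, HasFDerivAt (φ ∘ c) (0 : ℝ →L[ℝ] E) s := by
    intro s hs
    have h1 : MDifferentiableAt 𝓘(ℝ, E) 𝓘(ℝ, E) φ (c s) :=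
      ((contMDiffOn_chart (I := 𝓘(ℝ, E)) (n := ∞) (x := c s₀)).contMDiffAt
        (φ.open_source.mem_nhds (hball s hs).2)).mdifferentiableAt (by simp)
    have h2 := h1.hasMFDerivAt.comp s (hball s hs).1
    rw [ContinuousLinearMap.comp_zero] at h2
    exact hasMFDerivAt_iff_hasFDerivAt.1 h2
  filter_upwards [Metric.ball_mem_nhds s₀ hε] with s hs
  have h3 : (φ ∘ c) s = (φ ∘ c) s₀ := by
    refine (convex_ball s₀ ε).is_const_of_fderivWithin_eq_zero (𝕜 := ℝ)
      (fun x hx => (hd x hx).differentiableAt.differentiableWithinAt) (fun x hx => ?_) hs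
      (Metric.mem_ball_self hε)
    exact ((hd x hx).hasFDerivWithinAt).fderivWithin
      (Metric.isOpen_ball.uniqueDiffWithinAt hx)
  exact φ.injOn (hball s hs).2 (mem_chart_source E _) h3

section

variable {E : Type*} [NormedAddCommGroup E] [NormedSpace ℝ E]
  {M : Type*} [TopologicalSpace M] [ChartedSpace E M] [IsManifold 𝓘(ℝ, E) ∞ M]
  {EG : Type*} [NormedAddCommGroup EG] [NormedSpace ℝ EG] [FiniteDimensional ℝ EG]
  {G : Type*} [TopologicalSpace G] [ChartedSpace EG G] [Group G] [LieGroup 𝓘(ℝ, EG) ∞ G]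
  [MulAction G M]

/-- Where a smooth action is free, it is locally free. -/
theorem eq_zero_of_fundamentalField_eq_zero
    (hact : ContMDiff (𝓘(ℝ, EG).prod 𝓘(ℝ, E)) 𝓘(ℝ, E) ∞ (fun p : G × M => p.1 • p.2))
    {x : M} (hfree : ∀ g : G, g • x = x → g = 1) (ξ : GroupLieAlgebra 𝓘(ℝ, EG) G)
    (hξ : fundamentalField (E := E) ξ x = 0) : ξ = 0 := by
  have : LieGroup 𝓘(ℝ, EG) (minSmoothness ℝ 3) G :=
    LieGroup.of_le (n := ∞) (by simpa using ENat.LEInfty.out (m := 3))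
  have : LieGroup 𝓘(ℝ, EG) 1 G := LieGroup.of_le (n := ∞) (by simp)
  have : IsManifold 𝓘(ℝ, EG) 1 G := IsManifold.of_le (n := ∞) (by simp)
  have : CompleteSpace EG := FiniteDimensional.complete ℝ EG
  have horb : ContMDiff 𝓘(ℝ, EG) 𝓘(ℝ, E) ∞ (fun g : G => g • x) :=
    hact.comp (contMDiff_id.prodMk contMDiff_const)
  have hsmul : ∀ g : G, ContMDiff 𝓘(ℝ, E) 𝓘(ℝ, E) ∞ (fun y : M => g • y) := fun g =>
    hact.comp (contMDiff_const.prodMk contMDiff_id)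
  -- A local integral curve of the invariant field through 1 replaces the one-parameter subgroup of
  -- `ξ`.
  obtain ⟨γ, hγ0, hγ⟩ := exists_isMIntegralCurveAt_of_contMDiffAt_boundaryless (I := 𝓘(ℝ, EG)) 0
    ((contMDiff_mulInvariantVectorField (I := 𝓘(ℝ, EG)) ξ).contMDiffAt.of_le (by simp) :
      ContMDiffAt 𝓘(ℝ, EG) 𝓘(ℝ, EG).tangent 1
        (fun g : G => (mulInvariantVectorField ξ g : TangentBundle 𝓘(ℝ, EG) G)) 1)
  -- The orbit map intertwines left translation by `g` with the action of `g`, so its vanishing on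
  -- `ξ` at 1 propagates to every `g`.
  have hzero : ∀ g : G, mfderiv 𝓘(ℝ, EG) 𝓘(ℝ, E) (fun g : G => g • x) g
      (mulInvariantVectorField ξ g) = 0 := by
    intro g
    have hmul : MDifferentiableAt 𝓘(ℝ, EG) 𝓘(ℝ, EG) (fun h : G => g * h) 1 :=
      (contMDiff_mul_left (I := 𝓘(ℝ, EG)) (n := ∞) (a := g)).mdifferentiable (by simp) 1
    have ho : MDifferentiableAt 𝓘(ℝ, EG) 𝓘(ℝ, E) (fun g : G => g • x) (g * 1) :=
      horb.mdifferentiable (by simp) _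
    have h1 := ho.hasMFDerivAt.comp (1 : G) hmul.hasMFDerivAt
    have hs : MDifferentiableAt 𝓘(ℝ, E) 𝓘(ℝ, E) (fun y : M => g • y) ((1 : G) • x) :=
      (hsmul g).mdifferentiable (by simp) _
    have h2 := hs.hasMFDerivAt.comp (1 : G) (horb.mdifferentiable (by simp) 1).hasMFDerivAt
    have h3 : (fun g : G => g • x) ∘ (fun h : G => g * h) =
        (fun y : M => g • y) ∘ (fun g : G => g • x) := by
      funext h; exact mul_smul g h x
    rw [h3] at h1
    have h4 : mfderiv 𝓘(ℝ, EG) 𝓘(ℝ, E) (fun g : G => g • x) (g * 1)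
        (mulInvariantVectorField ξ g) = mfderiv 𝓘(ℝ, E) 𝓘(ℝ, E) (fun y : M => g • y) ((1 : G) • x)
          (mfderiv 𝓘(ℝ, EG) 𝓘(ℝ, E) (fun g : G => g • x) 1 ξ) :=
      congrArg (fun T : EG →L[ℝ] E => T ξ) (hasMFDerivAt_unique h1 h2)
    have h5 : mfderiv 𝓘(ℝ, EG) 𝓘(ℝ, E) (fun g : G => g • x) 1 ξ = 0 := hξ
    rw [h5] at h4
    rw [mul_one] at h4
    exact h4.trans (map_zero _)
  have hconst : ∀ᶠ s in 𝓝 (0 : ℝ), γ s • x = γ 0 • x := by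
    refine eventually_const_of_hasMFDerivAt_zero (E := E) (c := fun s => γ s • x) ?_
    filter_upwards [hγ] with s hs
    have h1 := (horb.mdifferentiable (by simp) (γ s)).hasMFDerivAt.comp s hs
    let A : EG →L[ℝ] E := mfderiv 𝓘(ℝ, EG) 𝓘(ℝ, E) (fun g : G => g • x) (γ s)
    let v : EG := mulInvariantVectorField ξ (γ s)
    have hAv : A v = 0 := hzero (γ s)
    have h2 : A.comp ((1 : ℝ →L[ℝ] ℝ).smulRight v) = 0 :=
      ContinuousLinearMap.ext fun r => by simp [hAv]
    exact h1.congr_mfderiv h2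
  have hone : ∀ᶠ s in 𝓝 (0 : ℝ), γ s = 1 := by
    filter_upwards [hconst] with s hs
    rw [hγ0, one_smul] at hs
    exact hfree _ hs
  have h1 := hγ.self_of_nhds
  have h2 : HasMFDerivAt 𝓘(ℝ, ℝ) 𝓘(ℝ, EG) γ 0 (0 : ℝ →L[ℝ] EG) :=
    (hasMFDerivAt_const (1 : G) (0 : ℝ)).congr_of_eventuallyEq hone
  have h3 : (1 : ℝ) • mulInvariantVectorField ξ (γ 0) = 0 :=
    congrArg (fun T : ℝ →L[ℝ] EG => T 1) (hasMFDerivAt_unique h1 h2)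
  rw [one_smul, hγ0] at h3
  -- The value of the invariant field at 1 is the differential of h ↦ 1 * h applied to `ξ`, that is,
  -- `ξ` itself.
  have h4 : HasMFDerivAt 𝓘(ℝ, EG) 𝓘(ℝ, EG) (fun g : G => 1 * g) 1 (ContinuousLinearMap.id ℝ EG) :=
    (hasMFDerivAt_id (1 : G)).congr_of_eventuallyEq (Filter.Eventually.of_forall one_mul)
  exact (congrArg (fun T : EG →L[ℝ] EG => T ξ) h4.mfderiv).symm.trans h3

end

/-! ### Lifts into submanifolds and the linear algebra of reduction. -/

/-- A differentiable map into the image of a smooth embedding lifts to the embedded manifold. -/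
theorem Manifold.IsSmoothEmbedding.exists_lift {E E' EP : Type*}
    [NormedAddCommGroup E] [NormedSpace ℝ E] [NormedAddCommGroup E'] [NormedSpace ℝ E']
    [NormedAddCommGroup EP] [NormedSpace ℝ EP]
    {Z M P : Type*} [TopologicalSpace Z] [ChartedSpace E Z] [IsManifold 𝓘(ℝ, E) ∞ Z]
    [TopologicalSpace M] [ChartedSpace E' M] [IsManifold 𝓘(ℝ, E') ∞ M]
    [TopologicalSpace P] [ChartedSpace EP P]
    {ι : Z → M} (hι : IsSmoothEmbedding 𝓘(ℝ, E) 𝓘(ℝ, E') ∞ ι) {c : P → M} {p : P} {z : Z}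
    (hz : c p = ι z) {c' : EP →L[ℝ] E'} (hc : HasMFDerivAt 𝓘(ℝ, EP) 𝓘(ℝ, E') c p c')
    (hr : ∀ᶠ q in 𝓝 p, c q ∈ Set.range ι) :
    ∃ (b : P → Z) (b' : EP →L[ℝ] E), b p = z ∧ HasMFDerivAt 𝓘(ℝ, EP) 𝓘(ℝ, E) b p b' ∧
      (∀ᶠ q in 𝓝 p, ι (b q) = c q) ∧
      ∀ u : EP, (mfderiv 𝓘(ℝ, E) 𝓘(ℝ, E') ι z : E →L[ℝ] E') (b' u) = c' u := by
  obtain ⟨k, hk, hkι⟩ :=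
    (hι.isImmersion.isImmersionOfComplement_complement z).exists_leftInverse
  have hkz : k (ι z) = z := hkι.self_of_nhds
  have hkd : MDifferentiableAt 𝓘(ℝ, E') 𝓘(ℝ, E) k (c p) := by
    rw [hz]; exact hk.mdifferentiableAt (by simp)
  have hb := hkd.hasMFDerivAt.comp p hc
  have hev : ∀ᶠ q in 𝓝 p, ι (k (c q)) = c q := by
    -- Since `ι` is a topological embedding, points of its range close to `ι z` come from points
    -- close to `z`, where `k` inverts `ι`.
    rw [hι.isEmbedding.nhds_eq_comap, Filter.eventually_comap] at hkι
    rw [← hz] at hkι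
    filter_upwards [hr, hc.continuousAt.eventually hkι] with q hq1 hq2
    obtain ⟨y, hy⟩ := hq1
    rw [← hy, hq2 y hy]
  have hbp : (k ∘ c) p = z := by rw [Function.comp_apply, hz, hkz]
  refine ⟨k ∘ c, _, hbp, hb, hev, fun u => ?_⟩
  have h1 : MDifferentiableAt 𝓘(ℝ, E) 𝓘(ℝ, E') ι ((k ∘ c) p) :=
    hι.contMDiff.mdifferentiable (by simp) _
  have h2 := h1.hasMFDerivAt.comp p hb
  have h3 := hc.congr_of_eventuallyEq (f₁ := ι ∘ k ∘ c) hev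
  have h4 := congrArg (fun T : EP →L[ℝ] E' => T u) (hasMFDerivAt_unique h2 h3)
  rw [← hbp]
  exact h4

/-- The tangent space at `x` is identified with `E` by the preferred chart at `x`, so a velocity in
this chart is the velocity in `M`. -/
theorem hasMFDerivAt_chartAt_symm {E : Type*} [NormedAddCommGroup E] [NormedSpace ℝ E]
    {M : Type*} [TopologicalSpace M] [ChartedSpace E M] (x : M) :
    HasMFDerivAt 𝓘(ℝ, E) 𝓘(ℝ, E) (chartAt E x).symm (chartAt E x x)
      (ContinuousLinearMap.id ℝ E) := by
  have hx : chartAt E x x ∈ (chartAt E x).target :=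
    (chartAt E x).map_source (mem_chart_source E x)
  refine ⟨(chartAt E x).symm.continuousAt hx, ?_⟩
  have h1 : HasFDerivAt (chartAt E x ∘ (chartAt E x).symm) (ContinuousLinearMap.id ℝ E)
      (chartAt E x x) := by
    refine (hasFDerivAt_id _).congr_of_eventuallyEq ?_
    filter_upwards [(chartAt E x).open_target.mem_nhds hx] with y hy
    exact (chartAt E x).right_inv hy
  have h2 : writtenInExtChartAt 𝓘(ℝ, E) 𝓘(ℝ, E) (chartAt E x x) (chartAt E x).symm =
      chartAt E x ∘ (chartAt E x).symm := by
    rw [writtenInExtChartAt, (chartAt E x).left_inv (mem_chart_source E x)]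
    simp [extChartAt]
    rfl
  rw [h2]
  exact h1.hasFDerivWithinAt

/-- Vertical vectors lie in `TS` as the fibre over 0 in `TL`, so `hcois` makes any `w` orthogonal to
`TS` tangent to the level set; `hlag` then applies to its projection. -/
theorem lagrangian_of_fiberProduct {TM TZ TN TL TS : Type*} [AddCommGroup TM] [Module ℝ TM]
    [AddCommGroup TZ] [Module ℝ TZ] [AddCommGroup TN] [Module ℝ TN] [AddCommGroup TL] [Module ℝ TL]
    [AddCommGroup TS] [Module ℝ TS] (Ω : TM → TM → ℝ) (Ω₀ : TN → TN → ℝ) (i : TZ →ₗ[ℝ] TM)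
    (p : TZ →ₗ[ℝ] TN) (d : TL →ₗ[ℝ] TN) (s₁ : TS →ₗ[ℝ] TL) (s₂ : TS →ₗ[ℝ] TZ)
    (hp : Function.Surjective p) (hform : ∀ u v, Ω₀ (p u) (p v) = Ω (i u) (i v))
    (hlag : ∀ w, (∃ u, d u = w) ↔ ∀ u, Ω₀ w (d u) = 0) (hcomm : ∀ u, d (s₁ u) = p (s₂ u))
    (hfib : ∀ a b, d a = p b → ∃ u, s₁ u = a ∧ s₂ u = b)
    (hcois : ∀ w, (∀ v, p v = 0 → Ω w (i v) = 0) → ∃ v, i v = w) (w : TM) :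
    (∃ u, i (s₂ u) = w) ↔ ∀ u, Ω w (i (s₂ u)) = 0 := by
  constructor
  · rintro ⟨u, rfl⟩ u'
    rw [← hform, ← hcomm, ← hcomm]
    exact (hlag _).1 ⟨_, rfl⟩ _
  · intro hw
    obtain ⟨v, rfl⟩ := hcois w fun v hv => by
      obtain ⟨u, -, rfl⟩ := hfib 0 v (by rw [hv, map_zero])
      exact hw u
    obtain ⟨a, ha⟩ := (hlag (p v)).2 fun a => by
      obtain ⟨b, hb⟩ := hp (d a)
      obtain ⟨u, -, rfl⟩ := hfib a b hb.symm
      rw [← hb, hform]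
      exact hw u
    obtain ⟨u, -, rfl⟩ := hfib a v ha
    exact ⟨u, rfl⟩

/-! ### The tangent space of the level set. -/

section

variable {E : Type*} [NormedAddCommGroup E] [NormedSpace ℝ E]
  {M : Type*} [TopologicalSpace M] [ChartedSpace E M] [IsManifold 𝓘(ℝ, E) ∞ M]
  {EG : Type*} [NormedAddCommGroup EG] [NormedSpace ℝ EG]
  {G : Type*} [TopologicalSpace G] [ChartedSpace EG G] [Group G]
  [MulAction G M] {Ω : TwoForm E M} {μ : M → Module.Dual ℝ (GroupLieAlgebra 𝓘(ℝ, EG) G)}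
  {t : Module.Dual ℝ (GroupLieAlgebra 𝓘(ℝ, EG) G)}
  {EZ : Type*} [NormedAddCommGroup EZ] [NormedSpace ℝ EZ]
  [ChartedSpace EZ (MomentLevel μ t)] [IsManifold 𝓘(ℝ, EZ) ∞ (MomentLevel μ t)]

/-- The orbit directions are tangent to the level set and vertical for the reduction map. -/
theorem exists_vertical_eq_fundamentalField (hμ : IsHamiltonianAction Ω μ) (ht : IsCentralValue t)
    (hι : IsSmoothEmbedding 𝓘(ℝ, EZ) 𝓘(ℝ, E) ∞ (Subtype.val : MomentLevel μ t → M))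
    {EN : Type*} [NormedAddCommGroup EN] [NormedSpace ℝ EN] [ChartedSpace EN (ReducedSpace μ t)]
    (hπ : ContMDiff 𝓘(ℝ, EZ) 𝓘(ℝ, EN) ∞ (reductionMap μ t))
    (z : MomentLevel μ t) (ξ : GroupLieAlgebra 𝓘(ℝ, EG) G) :
    ∃ v : EZ, (mfderiv 𝓘(ℝ, EZ) 𝓘(ℝ, E) (Subtype.val : MomentLevel μ t → M) z : EZ →L[ℝ] E) v =
        fundamentalField (E := E) ξ z.1 ∧
      (mfderiv 𝓘(ℝ, EZ) 𝓘(ℝ, EN) (reductionMap μ t) z : EZ →L[ℝ] EN) v = 0 := by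
  have horb : ContMDiff 𝓘(ℝ, EG) 𝓘(ℝ, E) ∞ (fun g : G => g • z.1) :=
    hμ.smooth_action.comp (contMDiff_id.prodMk contMDiff_const)
  -- Equivariance and centrality of `t` keep the orbit in the level set, so the orbit map lifts; the
  -- reduction map is constant along the lift.
  obtain ⟨b, b', hb1, hb, hev, hb'⟩ := hι.exists_lift (c := fun g : G => g • z.1) (z := z)
    (one_smul G z.1)
    (horb.mdifferentiable (by simp) 1).hasMFDerivAt
    (Filter.Eventually.of_forall fun g => ⟨⟨g • z.1, by rw [hμ.equivariant, z.2, ht]⟩, rfl⟩)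
  refine ⟨b' ξ, hb' ξ, ?_⟩
  have hconst : ∀ᶠ g in 𝓝 (1 : G), (reductionMap μ t ∘ b) g = reductionMap μ t z := by
    filter_upwards [hev] with g hg
    refine Quotient.sound (s := levelOrbitRel μ t) ?_
    exact ⟨g, hg.symm⟩
  have h1 : MDifferentiableAt 𝓘(ℝ, EZ) 𝓘(ℝ, EN) (reductionMap μ t) (b 1) :=
    hπ.mdifferentiable (by simp) _
  have h2 := h1.hasMFDerivAt.comp (1 : G) hb
  have h3 : HasMFDerivAt 𝓘(ℝ, EG) 𝓘(ℝ, EN) (reductionMap μ t ∘ b) 1 (0 : EG →L[ℝ] EN) :=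
    (hasMFDerivAt_const (reductionMap μ t z) (1 : G)).congr_of_eventuallyEq hconst
  have h4 := congrArg (fun T : EG →L[ℝ] EN => T ξ) (hasMFDerivAt_unique h2 h3)
  rw [← hb1]
  exact h4

/-- The tangent space of the level set is the common kernel of the differentials of the components
of the moment map. -/
theorem exists_tangent_of_mfderiv_moment_eq_zero [FiniteDimensional ℝ E] [FiniteDimensional ℝ EG]
    [LieGroup 𝓘(ℝ, EG) ∞ G] (hΩ : IsSymplecticForm Ω)
    (hμ : IsHamiltonianAction Ω μ) (hfree : ∀ x : M, μ x = t → ∀ g : G, g • x = x → g = 1)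
    (hι : IsSmoothEmbedding 𝓘(ℝ, EZ) 𝓘(ℝ, E) ∞ (Subtype.val : MomentLevel μ t → M))
    (z : MomentLevel μ t) (w : E)
    (hw : ∀ ξ : GroupLieAlgebra 𝓘(ℝ, EG) G,
      (mfderiv 𝓘(ℝ, E) 𝓘(ℝ, ℝ) (fun y => μ y ξ) z.1 : E →L[ℝ] ℝ) w = 0) :
    ∃ v : EZ, (mfderiv 𝓘(ℝ, EZ) 𝓘(ℝ, E) (Subtype.val : MomentLevel μ t → M) z :
      EZ →L[ℝ] E) v = w := by
  have : CompleteSpace E := FiniteDimensional.complete ℝ E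
  let b := Module.finBasis ℝ EG
  let ν : M → Module.Dual ℝ EG := μ
  let m : M → Fin (Module.finrank ℝ EG) → ℝ := fun y i => ν y (b i)
  have hm : ContMDiff 𝓘(ℝ, E) 𝓘(ℝ, Fin (Module.finrank ℝ EG) → ℝ) ∞ m :=
    contMDiff_pi_space.2 fun i => hμ.smooth_moment (b i)
  have hlevel : ∀ y, m y = m z.1 → μ y = t := by
    intro y hy
    rw [← z.2]
    exact b.ext (f₁ := ν y) (f₂ := ν z.1) fun i => congrFun hy i
  let φ := chartAt E z.1
  let m' : E →L[ℝ] (Fin (Module.finrank ℝ EG) → ℝ) :=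
    mfderiv 𝓘(ℝ, E) 𝓘(ℝ, Fin (Module.finrank ℝ EG) → ℝ) m z.1
  have hmd := (hm.mdifferentiable (by simp) z.1).hasMFDerivAt
  have hcomp : ∀ (F : (Fin (Module.finrank ℝ EG) → ℝ) →L[ℝ] ℝ) (u : E),
      (mfderiv 𝓘(ℝ, E) 𝓘(ℝ, ℝ) (F ∘ m) z.1 : E →L[ℝ] ℝ) u = F (m' u) := fun F u =>
    congrArg (fun T : E →L[ℝ] ℝ => T u) (F.hasMFDerivAt.comp z.1 hmd).mfderiv
  -- Regularity of `t`: a functional `F` killing the range corresponds to a `ξ` with d⟨μ,ξ⟩ = 0 at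
  -- `z`. Nondegeneracy gives ξ_M = 0 there, and local freeness gives ξ = 0, so F = 0.
  have hsurj : m'.range = ⊤ := by
    by_contra hne
    obtain ⟨F, hF, hle⟩ := Submodule.exists_le_ker_of_lt_top _ (lt_top_iff_ne_top.2 hne)
    let ξ : EG := ∑ i, F (Pi.single i 1) • b i
    have hFm : (fun y => ν y ξ) = LinearMap.toContinuousLinearMap F ∘ m := by
      funext y
      simp only [ξ, map_sum, map_smul, Function.comp_apply, LinearMap.coe_toContinuousLinearMap']
      rw [LinearMap.pi_apply_eq_sum_univ F (m y)]
      refine Finset.sum_congr rfl fun i _ => ?_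
      simp only [smul_eq_mul, m]
      rw [mul_comm]
      congr 2
      funext k
      simp [Pi.single_apply, eq_comm]
    have hξ0 : ξ = 0 := by
      refine eq_zero_of_fundamentalField_eq_zero hμ.smooth_action (hfree z.1 z.2) ξ ?_
      refine hΩ.nondegenerate z.1 _ fun v => ?_
      refine (hμ.moment ξ z.1 v).symm.trans ?_
      change (mfderiv 𝓘(ℝ, E) 𝓘(ℝ, ℝ) (fun y => ν y ξ) z.1 : E →L[ℝ] ℝ) v = 0
      rw [hFm]
      exact (hcomp _ v).trans (hle ⟨v, rfl⟩)
    have hF0 : ∀ i, F (Pi.single i 1) = 0 :=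
      Fintype.linearIndependent_iff.1 b.linearIndependent _ hξ0
    apply hF
    ext i
    simpa using hF0 i
  have hw' : m' w = 0 := by
    funext i
    exact (hcomp (ContinuousLinearMap.proj i) w).symm.trans (hw (b i))
  have hφz : φ z.1 ∈ φ.target := φ.map_source (mem_chart_source E z.1)
  have hstrict : HasStrictFDerivAt (m ∘ φ.symm) m' (φ z.1) := by
    have h1 : ContDiffAt ℝ ∞ (m ∘ φ.symm) (φ z.1) := by
      rw [← contMDiffAt_iff_contDiffAt]
      exact (hm _).comp _ ((contMDiffOn_chart_symm (I := 𝓘(ℝ, E)) (x := z.1)).contMDiffAt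
        (φ.open_target.mem_nhds hφz))
    refine h1.hasStrictFDerivAt' ?_ (by simp)
    have h2 := hmd.2
    simp only [writtenInExtChartAt, extChartAt, mfld_simps] at h2
    exact hasFDerivWithinAt_univ.1 h2
  have hφφ : φ.symm (φ z.1) = z.1 := φ.left_inv (mem_chart_source E z.1)
  let a₀ := (m ∘ φ.symm) (φ z.1)
  -- The implicit function along the line through `w` in the kernel gives a curve in the level set
  -- with velocity `w` at 0.
  let k : ℝ → m'.ker := fun s => s • ⟨w, hw'⟩
  let c₀ : ℝ → E := fun s => hstrict.implicitFunction (m ∘ φ.symm) m' hsurj a₀ (k s)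
  have hk0 : k 0 = 0 := zero_smul _ _
  have hc₀0 : c₀ 0 = φ z.1 := by
    change hstrict.implicitFunction (m ∘ φ.symm) m' hsurj a₀ (k 0) = _
    rw [hk0]
    exact hstrict.implicitFunction_apply_image hsurj
  have hkd : HasFDerivAt k ((1 : ℝ →L[ℝ] ℝ).smulRight (⟨w, hw'⟩ : m'.ker)) 0 :=
    (1 : ℝ →L[ℝ] ℝ).hasFDerivAt.smul_const _
  have hc₀ : HasFDerivAt c₀ ((1 : ℝ →L[ℝ] ℝ).smulRight w) 0 := by
    have h1 := (hstrict.to_implicitFunction hsurj).hasFDerivAt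
    rw [← hk0] at h1
    exact h1.comp 0 hkd
  have hcm : HasMFDerivAt 𝓘(ℝ, ℝ) 𝓘(ℝ, E) (φ.symm ∘ c₀) 0 ((1 : ℝ →L[ℝ] ℝ).smulRight w) := by
    have h1 := hasMFDerivAt_chartAt_symm (E := E) z.1
    change HasMFDerivAt 𝓘(ℝ, E) 𝓘(ℝ, E) φ.symm (φ z.1) _ at h1
    rw [← hc₀0] at h1
    exact h1.comp 0 hc₀.hasMFDerivAt
  have hlev : ∀ᶠ s in 𝓝 (0 : ℝ), (φ.symm ∘ c₀) s ∈
      Set.range (Subtype.val : MomentLevel μ t → M) := by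
    have h1 := hstrict.map_implicitFunction_eq hsurj
    have h2 : Filter.Tendsto (fun s : ℝ => (a₀, k s)) (𝓝 0) (𝓝 (a₀, 0)) := by
      rw [← hk0]
      exact (continuousAt_const.prodMk hkd.continuousAt)
    filter_upwards [h2.eventually h1] with s hs
    refine ⟨⟨φ.symm (c₀ s), hlevel _ ?_⟩, rfl⟩
    refine Eq.trans hs ?_
    change m (φ.symm (φ z.1)) = _
    rw [hφφ]
  obtain ⟨-, b', -, -, -, hb'⟩ := hι.exists_lift (z := z)
    (by rw [Function.comp_apply, hc₀0, hφφ]) hcm hlev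
  exact ⟨b' 1, (hb' 1).trans (one_smul ℝ w)⟩

end

/-! ### Preimages of Lagrangian immersions and embeddings. -/

section

variable {E : Type*} [NormedAddCommGroup E] [NormedSpace ℝ E]
  {M : Type*} [TopologicalSpace M] [ChartedSpace E M] [IsManifold 𝓘(ℝ, E) ∞ M]
  {EG : Type*} [NormedAddCommGroup EG] [NormedSpace ℝ EG]
  {G : Type*} [TopologicalSpace G] [ChartedSpace EG G] [Group G]
  [MulAction G M] {Ω : TwoForm E M} {μ : M → Module.Dual ℝ (GroupLieAlgebra 𝓘(ℝ, EG) G)}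
  {t : Module.Dual ℝ (GroupLieAlgebra 𝓘(ℝ, EG) G)}
  {EZ : Type*} [NormedAddCommGroup EZ] [NormedSpace ℝ EZ]
  [ChartedSpace EZ (MomentLevel μ t)] [IsManifold 𝓘(ℝ, EZ) ∞ (MomentLevel μ t)]
  {EN : Type*} [NormedAddCommGroup EN] [NormedSpace ℝ EN]
  [ChartedSpace EN (ReducedSpace μ t)]
  {Ωt : TwoForm EN (ReducedSpace μ t)}
  {EL : Type*} [NormedAddCommGroup EL] [NormedSpace ℝ EL]
  {L : Type*} [TopologicalSpace L] [ChartedSpace EL L]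

/-- The level set is coisotropic, with the vertical directions as characteristic directions. -/
theorem exists_tangent_of_orthogonal_vertical [FiniteDimensional ℝ E]
    [FiniteDimensional ℝ EG] [LieGroup 𝓘(ℝ, EG) ∞ G] (hΩ : IsSymplecticForm Ω)
    (hμ : IsHamiltonianAction Ω μ) (ht : IsCentralValue t)
    (hfree : ∀ x : M, μ x = t → ∀ g : G, g • x = x → g = 1)
    (hred : IsSymplecticReduction (EZ := EZ) Ω μ t Ωt) (z : MomentLevel μ t) (w : E)
    (hw : ∀ v : EZ, (mfderiv 𝓘(ℝ, EZ) 𝓘(ℝ, EN) (reductionMap μ t) z : EZ →L[ℝ] EN) v = 0 →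
      (Ω z.1 : E [⋀^Fin 2]→L[ℝ] ℝ) ![w, (mfderiv 𝓘(ℝ, EZ) 𝓘(ℝ, E)
        (Subtype.val : MomentLevel μ t → M) z : EZ →L[ℝ] E) v] = 0) :
    ∃ v : EZ, (mfderiv 𝓘(ℝ, EZ) 𝓘(ℝ, E) (Subtype.val : MomentLevel μ t → M) z :
      EZ →L[ℝ] E) v = w := by
  refine exists_tangent_of_mfderiv_moment_eq_zero hΩ hμ hfree hred.inclusion z w fun ξ => ?_
  obtain ⟨v, hv, hv0⟩ := exists_vertical_eq_fundamentalField hμ ht hred.inclusion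
    hred.projection.contMDiff z ξ
  have h1 := hw v hv0
  rw [hv] at h1
  refine (hμ.moment ξ z.1 w).trans ?_
  -- The moment condition has ξ_M in the first slot, the orthogonality hypothesis in the second.
  let B : E [⋀^Fin 2]→L[ℝ] ℝ := Ω z.1
  have h2 : ∀ a b : E, B ![b, a] = -B ![a, b] := by
    intro a b
    have h3 := B.toAlternatingMap.map_swap ![a, b] (show (0 : Fin 2) ≠ 1 by decide)
    have h4 : (![a, b] ∘ Equiv.swap (0 : Fin 2) 1) = ![b, a] := by
      funext i; fin_cases i <;> simp
    rw [h4] at h3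
    exact h3
  exact (h2 w _).trans (neg_eq_zero.2 h1)

/-- The preimage of a Lagrangian immersion into the reduced space is Lagrangian. -/
theorem exists_lagrangianImmersion_of_fiberProduct [FiniteDimensional ℝ E]
    [FiniteDimensional ℝ EG] [FiniteDimensional ℝ EZ] [FiniteDimensional ℝ EN]
    [FiniteDimensional ℝ EL] [LieGroup 𝓘(ℝ, EG) ∞ G] [IsManifold 𝓘(ℝ, EN) ∞ (ReducedSpace μ t)]
    [IsManifold 𝓘(ℝ, EL) ∞ L] (hΩ : IsSymplecticForm Ω)
    (hμ : IsHamiltonianAction Ω μ) (ht : IsCentralValue t)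
    (hfree : ∀ x : M, μ x = t → ∀ g : G, g • x = x → g = 1)
    (hred : IsSymplecticReduction (EZ := EZ) Ω μ t Ωt) {f : L → ReducedSpace μ t}
    (hf : IsLagrangianImmersion EL Ωt f) {S : Type*} [TopologicalSpace S]
    {j : S → L × MomentLevel μ t} (hj : Topology.IsEmbedding j)
    (hrange : ∀ p, p ∈ Set.range j ↔ f p.1 = reductionMap μ t p.2) :
    ∃ (k : ℕ) (_ : ChartedSpace (EuclideanSpace ℝ (Fin k)) S), IsManifold (𝓡 k) ∞ S ∧
      IsLagrangianImmersion (EuclideanSpace ℝ (Fin k)) Ω (fun s => ((j s).2 : M)) := by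
  -- The dimension counts below need a point of `S`; if there is none, k = 0 serves.
  rcases isEmpty_or_nonempty S with hS | ⟨⟨s₀⟩⟩
  · let _ := ChartedSpace.empty (EuclideanSpace ℝ (Fin 0)) S
    exact ⟨0, inferInstance, inferInstance,
      IsImmersionOfComplement.isImmersion (F := PUnit.{1}) (fun s => (hS.false s).elim),
      fun s => (hS.false s).elim⟩
  have hι := hred.inclusion
  have hπ := hred.projection.isSubmersionOfComplement_complement
  -- The splitting of `EZ` as `EN` times the fibre model makes the latter finite-dimensional and
  -- gives k + dim EN = dim EL + dim EZ.
  have e₀ := (hπ (j s₀).2).equiv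
  have : FiniteDimensional ℝ hred.projection.complement :=
    FiniteDimensional.of_surjective
      ((LinearMap.snd ℝ EN hred.projection.complement).comp (e₀ : EZ →ₗ[ℝ] _))
      (Prod.snd_surjective.comp e₀.surjective)
  have hdim₀ := e₀.toLinearEquiv.finrank_eq
  rw [Module.finrank_prod] at hdim₀
  let k := Module.finrank ℝ (EL × hred.projection.complement)
  have hk : k = Module.finrank ℝ EL + Module.finrank ℝ hred.projection.complement :=
    Module.finrank_prod
  let T : (EL × hred.projection.complement) ≃L[ℝ] EuclideanSpace ℝ (Fin k) :=
    ContinuousLinearEquiv.ofFinrankEq (by simp [k])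
  obtain ⟨cs, hman, hjs, hjinj⟩ := exists_chartedSpace_fiberProduct T hf.isImmersion.contMDiff hπ
    hj hrange
  refine ⟨k, cs, hman, ?_⟩
  let z : S → MomentLevel μ t := fun s => (j s).2
  have hjs₁ : ContMDiff (𝓡 k) 𝓘(ℝ, EL) ∞ (fun s => (j s).1) := contMDiff_fst.comp hjs
  have hjs₂ : ContMDiff (𝓡 k) 𝓘(ℝ, EZ) ∞ z := contMDiff_snd.comp hjs
  have hincl : ContMDiff (𝓡 k) 𝓘(ℝ, E) ∞ (fun s => (z s : M)) := hι.contMDiff.comp hjs₂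
  let i : S → EZ →L[ℝ] E := fun s =>
    mfderiv 𝓘(ℝ, EZ) 𝓘(ℝ, E) (Subtype.val : MomentLevel μ t → M) (z s)
  let p : S → EZ →L[ℝ] EN := fun s => mfderiv 𝓘(ℝ, EZ) 𝓘(ℝ, EN) (reductionMap μ t) (z s)
  let d : S → EL →L[ℝ] EN := fun s => mfderiv 𝓘(ℝ, EL) 𝓘(ℝ, EN) f (j s).1
  let s₁ : S → EuclideanSpace ℝ (Fin k) →L[ℝ] EL := fun s =>
    mfderiv (𝓡 k) 𝓘(ℝ, EL) (fun s => (j s).1) s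
  let s₂ : S → EuclideanSpace ℝ (Fin k) →L[ℝ] EZ := fun s => mfderiv (𝓡 k) 𝓘(ℝ, EZ) z s
  have hfj : ∀ s, f (j s).1 = reductionMap μ t (z s) := fun s => (hrange _).1 ⟨s, rfl⟩
  have hi : ∀ s, Function.Injective (i s) := fun s => by
    obtain ⟨g, hg, hgf⟩ :=
      (hι.isImmersion.isImmersionOfComplement_complement (z s)).exists_leftInverse
    exact injective_mfderiv_of_leftInverse (hι.contMDiff.mdifferentiable (by simp) _)
      (hg.mdifferentiableAt (by simp)) hgf
  have hd : ∀ s, Function.Injective (d s) := fun s => by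
    obtain ⟨g, hg, hgf⟩ :=
      (hf.isImmersion.isImmersionOfComplement_complement (j s).1).exists_leftInverse
    exact injective_mfderiv_of_leftInverse (hf.isImmersion.contMDiff.mdifferentiable (by simp) _)
      (hg.mdifferentiableAt (by simp)) hgf
  have hcomm : ∀ s u, d s (s₁ s u) = p s (s₂ s u) := fun s u => by
    have h1 := ((hf.isImmersion.contMDiff.mdifferentiable (by simp) (j s).1).hasMFDerivAt).comp s
      (hjs₁.mdifferentiable (by simp) s).hasMFDerivAt
    have h2 := ((hred.projection.contMDiff.mdifferentiable (by simp) (z s)).hasMFDerivAt).comp s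
      (hjs₂.mdifferentiable (by simp) s).hasMFDerivAt
    have h3 : f ∘ (fun s => (j s).1) = reductionMap μ t ∘ z := funext hfj
    rw [h3] at h1
    exact congrArg (fun A : EuclideanSpace ℝ (Fin k) →L[ℝ] EN => A u) (hasMFDerivAt_unique h1 h2)
  have hinc : ∀ s u, (mfderiv (𝓡 k) 𝓘(ℝ, E) (fun s => (z s : M)) s :
      EuclideanSpace ℝ (Fin k) →L[ℝ] E) u = i s (s₂ s u) := fun s u => by
    have h1 := ((hι.contMDiff.mdifferentiable (by simp) (z s)).hasMFDerivAt).comp s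
      (hjs₂.mdifferentiable (by simp) s).hasMFDerivAt
    exact congrArg (fun A : EuclideanSpace ℝ (Fin k) →L[ℝ] E => A u) h1.mfderiv
  have hs₁₂ : ∀ s, Function.Injective (fun u => (s₁ s u, s₂ s u)) := fun s u v huv => by
    refine hjinj s ?_
    have h1 := ((hjs₁.mdifferentiable (by simp) s).hasMFDerivAt.prodMk
      (hjs₂.mdifferentiable (by simp) s).hasMFDerivAt).mfderiv
    have h2 : ∀ u : EuclideanSpace ℝ (Fin k), (mfderiv (𝓡 k) (𝓘(ℝ, EL).prod 𝓘(ℝ, EZ)) j s :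
        EuclideanSpace ℝ (Fin k) →L[ℝ] EL × EZ) u = (s₁ s u, s₂ s u) := fun u =>
      congrArg (fun A : EuclideanSpace ℝ (Fin k) →L[ℝ] EL × EZ => A u) h1
    exact (h2 u).trans (huv.trans (h2 v).symm)
  -- The `L`-component of a tangent vector is determined by the other one, because df is injective.
  have hs₂ : ∀ s, Function.Injective (s₂ s) := fun s u v huv => by
    refine hs₁₂ s (Prod.ext (hd s ?_) huv)
    change d s (s₁ s u) = d s (s₁ s v)
    rw [hcomm, hcomm, huv]
  have hp : ∀ s, Function.Surjective (p s) := fun s => (hπ (z s)).surjective_mfderiv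
  have hinj : ∀ s, Function.Injective (mfderiv (𝓡 k) 𝓘(ℝ, E) (fun s => (z s : M)) s) :=
    fun s u v huv => hs₂ s (hi s (((hinc s u).symm.trans huv).trans (hinc s v)))
  constructor
  · have hkE : k ≤ Module.finrank ℝ E := by
      have h1 := LinearMap.finrank_le_finrank_of_injective
        (f := (i s₀ ∘L s₂ s₀ : EuclideanSpace ℝ (Fin k) →ₗ[ℝ] E)) ((hi s₀).comp (hs₂ s₀))
      rwa [finrank_euclideanSpace_fin] at h1
    have himm : IsImmersionOfComplement (EuclideanSpace ℝ (Fin (Module.finrank ℝ E - k))) (𝓡 k)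
        𝓘(ℝ, E) ∞ (fun s => (z s : M)) := fun s =>
      IsImmersionAtOfComplement.of_injective_mfderiv
        (by rw [finrank_euclideanSpace_fin, finrank_euclideanSpace_fin]; omega) hincl s (hinj s)
    exact himm.isImmersion
  · intro s w
    have hfib : ∀ (a : EL) (b : EZ), d s a = p s b → ∃ u, s₁ s u = a ∧ s₂ s u = b := by
      intro a b hab
      obtain ⟨u, hu⟩ := LinearMap.exists_eq_of_fiberProduct
        ((s₁ s).toLinearMap.prod (s₂ s).toLinearMap) (hs₁₂ s) (d s).toLinearMap (p s).toLinearMap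
        (hp s) (hcomm s) (by rw [finrank_euclideanSpace_fin]; omega) a b hab
      exact ⟨u, congrArg Prod.fst hu, congrArg Prod.snd hu⟩
    have hform : ∀ a b : EN, (Ωt (f (j s).1) : EN [⋀^Fin 2]→L[ℝ] ℝ) ![a, b] =
        (Ωt (reductionMap μ t (z s)) : EN [⋀^Fin 2]→L[ℝ] ℝ) ![a, b] := fun a b => by rw [hfj]
    have h := lagrangian_of_fiberProduct
      (fun a b : E => (Ω (z s).1 : E [⋀^Fin 2]→L[ℝ] ℝ) ![a, b])
      (fun a b : EN => (Ωt (reductionMap μ t (z s)) : EN [⋀^Fin 2]→L[ℝ] ℝ) ![a, b])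
      (i s).toLinearMap (p s).toLinearMap (d s).toLinearMap (s₁ s).toLinearMap (s₂ s).toLinearMap
      (hp s) (hred.form (z s))
      (fun w => (hf.lagrangian (j s).1 w).trans
        (forall_congr' fun u => Eq.congr_left (hform w (d s u))))
      (hcomm s) hfib
      (fun w hw => exists_tangent_of_orthogonal_vertical hΩ hμ ht hfree hred (z s) w hw) w
    refine Iff.trans (exists_congr fun u => ?_) (h.trans (forall_congr' fun u => ?_))
    · exact Eq.congr_left (hinc s u)
    · exact Eq.congr_left (congrArg
        (fun v : E => (Ω (z s).1 : E [⋀^Fin 2]→L[ℝ] ℝ) ![w, v]) (hinc s u).symm)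

/-- The preimage of an embedded subset of the reduced space, as a fibre product. -/
theorem exists_embedding_reductionPreimage {f : L → ReducedSpace μ t}
    (hf : Topology.IsEmbedding f) (hπ : Continuous (reductionMap μ t)) :
    ∃ j : reductionPreimage μ t (Set.range f) → L × MomentLevel μ t, Topology.IsEmbedding j ∧
      (∀ p, p ∈ Set.range j ↔ f p.1 = reductionMap μ t p.2) ∧ ∀ s, ((j s).2 : M) = s.1 := by
  have hs : ∀ s : reductionPreimage μ t (Set.range f), ∃ z : MomentLevel μ t, ∃ l, f l =
      reductionMap μ t z ∧ z.1 = s.1 := by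
    rintro ⟨_, z, ⟨l, hl⟩, rfl⟩
    exact ⟨z, l, hl, rfl⟩
  choose z l hl hz using hs
  have hzc : Continuous z := by
    rw [Topology.IsEmbedding.subtypeVal.continuous_iff]
    exact continuous_subtype_val.congr fun s => (hz s).symm
  -- Here `f` must be a topological embedding: `l` is continuous because `f ∘ l` is.
  have hlc : Continuous l := by
    rw [hf.continuous_iff]
    exact (hπ.comp hzc).congr fun s => (hl s).symm
  refine ⟨fun s => (l s, z s), ?_, fun p => ⟨?_, fun hp => ?_⟩, hz⟩
  · refine Topology.IsEmbedding.of_comp (hlc.prodMk hzc)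
      (continuous_subtype_val.comp continuous_snd) ?_
    have h1 : (Subtype.val ∘ Prod.snd) ∘ (fun s => (l s, z s)) = Subtype.val := funext hz
    rw [h1]
    exact Topology.IsEmbedding.subtypeVal
  · rintro ⟨s, rfl⟩
    exact hl s
  · let s : reductionPreimage μ t (Set.range f) := ⟨p.2.1, p.2, ⟨p.1, hp⟩, rfl⟩
    have h1 : z s = p.2 := Subtype.ext (hz s)
    refine ⟨s, Prod.ext (hf.injective ?_) h1⟩
    change f (l s) = _
    rw [hl, h1, hp]

end

theorem mainTheorem2
    -- a compact symplectic manifold `(M, Ω)`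
    {E : Type*} [NormedAddCommGroup E] [NormedSpace ℝ E] [FiniteDimensional ℝ E]
    {M : Type*} [TopologicalSpace M] [ChartedSpace E M] [IsManifold 𝓘(ℝ, E) ∞ M]
    [T2Space M] [CompactSpace M]
    (Ω : TwoForm E M) (hΩ : IsSymplecticForm Ω)
    -- a Lie group `G` acting on it with moment map `μ`
    {EG : Type*} [NormedAddCommGroup EG] [NormedSpace ℝ EG] [FiniteDimensional ℝ EG]
    {G : Type*} [TopologicalSpace G] [ChartedSpace EG G] [Group G] [LieGroup 𝓘(ℝ, EG) ∞ G]
    [T2Space G] [MulAction G M]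
    (μ : M → Module.Dual ℝ (GroupLieAlgebra 𝓘(ℝ, EG) G)) (hμ : IsHamiltonianAction Ω μ)
    -- a central value `t` such that `G` acts freely on its level set
    (t : Module.Dual ℝ (GroupLieAlgebra 𝓘(ℝ, EG) G)) (ht : IsCentralValue t)
    (hfree : ∀ x : M, μ x = t → ∀ g : G, g • x = x → g = 1)
    -- the manifolds `μ⁻¹(t)` and `N_t = μ⁻¹(t) / G`, and the reduced form on `N_t`
    {EZ : Type*} [NormedAddCommGroup EZ] [NormedSpace ℝ EZ] [FiniteDimensional ℝ EZ]
    [ChartedSpace EZ (MomentLevel μ t)] [IsManifold 𝓘(ℝ, EZ) ∞ (MomentLevel μ t)]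
    {EN : Type*} [NormedAddCommGroup EN] [NormedSpace ℝ EN] [FiniteDimensional ℝ EN]
    [ChartedSpace EN (ReducedSpace μ t)] [IsManifold 𝓘(ℝ, EN) ∞ (ReducedSpace μ t)]
    (Ωt : TwoForm EN (ReducedSpace μ t)) (hred : IsSymplecticReduction (EZ := EZ) Ω μ t Ωt)
    -- a manifold `L` with a map to `N_t`
    {EL : Type*} [NormedAddCommGroup EL] [NormedSpace ℝ EL] [FiniteDimensional ℝ EL]
    {L : Type*} [TopologicalSpace L] [ChartedSpace EL L] [IsManifold 𝓘(ℝ, EL) ∞ L]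
    (f : L → ReducedSpace μ t) :
    -- embeddings: the preimage of the submanifold `f(L)`, with the subspace topology of `M`
    (IsLagrangianEmbedding EL Ωt f →
      ∃ (k : ℕ) (_ : ChartedSpace (EuclideanSpace ℝ (Fin k))
          (reductionPreimage μ t (Set.range f))),
        IsManifold (𝓡 k) ∞ (reductionPreimage μ t (Set.range f)) ∧
        IsLagrangianEmbedding (EuclideanSpace ℝ (Fin k)) Ω
          (Subtype.val : reductionPreimage μ t (Set.range f) → M)) ∧
    -- immersions: the fibre product of `f` and `π_t`, with its projection to `μ⁻¹(t) ⊂ M`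
    (IsLagrangianImmersion EL Ωt f →
      ∃ (k : ℕ) (_ : ChartedSpace (EuclideanSpace ℝ (Fin k)) (reductionPullback μ t f)),
        IsManifold (𝓡 k) ∞ (reductionPullback μ t f) ∧
        IsLagrangianImmersion (EuclideanSpace ℝ (Fin k)) Ω
          (fun p : reductionPullback μ t f => (p.1.2 : M))) := by
  refine ⟨fun hf => ?_, fun hf => ?_⟩
  -- With the subspace topology the preimage is itself a fibre product, so the immersion case
  -- applies, and its inclusion is a topological embedding for free.
  · obtain ⟨j, hj, hrange, hjs⟩ := exists_embedding_reductionPreimage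
      hf.isSmoothEmbedding.isEmbedding hred.projection.contMDiff.continuous
    obtain ⟨k, cs, hman, hlag⟩ := exists_lagrangianImmersion_of_fiberProduct hΩ hμ ht hfree hred
      ⟨hf.isSmoothEmbedding.isImmersion, hf.lagrangian⟩ hj hrange
    rw [show (fun s => ((j s).2 : M)) = Subtype.val from funext hjs] at hlag
    exact ⟨k, cs, hman, ⟨hlag.isImmersion, Topology.IsEmbedding.subtypeVal⟩, hlag.lagrangian⟩
  · exact exists_lagrangianImmersion_of_fiberProduct hΩ hμ ht hfree hred hf
      Topology.IsEmbedding.subtypeVal fun p => by simp
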